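/- Work in $\mathbb C^3\otimes\mathbb C^3$ (Alice $\otimes$ Bob). A \emph{product state} is a vector $\alpha\otimes\beta$ with $\alpha,\beta$ unit vectors. A \emph{product basis} (PB) is a set $S$ of mutually orthogonal product states (not necessarily spanning). It is \emph{completable} if it is contained in a PB that spans $\mathbb C^3\otimes\mathbb C^3$. It is an \emph{unextendible product basis} (UPB) if $S^\perp$ contains no product state and, moreover, $S^\perp$ contains fewer mutually orthogonal product states than its dimension (so $S$ is not a full basis). The \emph{orthogonality graph} of a PB $\{\alpha_i\otimes\beta_i\}$ has the states as vertices, with an edge of Alice's colour between $k\ne l$ iff $\alpha_k\perp\alpha_l$ and an edge of Bob's colour iff $\beta_k\perp\beta_l$. The \emph{pentagon graph} has five vertices; Alice's edges form a 5-cycle and Bob's edges are exactly the other five pairs. For angles $p=(\gamma,\theta,\phi)\in\mathbb R^3$ put $N=\sqrt{\cos^2\gamma+\sin^2\gamma\cos^2\theta}$ and \[ \begin{aligned} v_0&=|0\rangle,\qquad v_1=|1\rangle,\qquad v_2=\cos\theta\,|0\rangle+\sin\theta\,|2\rangle,\\ v_3&=\sin\gamma\sin\theta\,|0\rangle-\sin\gamma\cos\theta\,|2\rangle+\cos\gamma\,e^{i\phi}|1\rangle,\\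 v_4&=\tfrac1N\left(\sin\gamma\cos\theta\,e^{i\phi}|1\rangle+\cos\gamma\,|2\rangle\right), \end{aligned} \] with $\tfrac1N$ read as $0$ if $N=0$. For $p_A=(\gamma_A,\theta_A,\phi_A)$ and $p_B=(\gamma_B,\theta_B,\phi_B)$ let $S(p_A,p_B)=\{\alpha_i\otimes\beta_i: 0\le i\le 4\}$, where $(\alpha_0,\dots,\alpha_4)=(v_0,v_1,v_2,v_3,v_4)$ for $p_A$ and $(\beta_0,\dots,\beta_4)=(v_1,v_3,v_0,v_2,v_4)$ for $p_B$. Call $p$ \emph{nondegenerate} if $\cos\theta,\cos\gamma,\sin\theta,\sin\gamma$ are all nonzero. A \emph{separable measurement} has finitely many outcomes $k$, each with finitely many operation elements $A_i^k\otimes B_i^k$ (maps $\mathbb C^3\otimes\mathbb C^3\to\mathbb C^{m'}\otimes\mathbb C^{n'}$) such that $\sum_{k,i}A_i^{k\dagger}A_i^k\otimes B_i^{k\dagger}B_i^k=\mathbf 1$; outcome $k$ has probability $\sum_i\|(A_i^k\otimes B_i^k)\psi\|^2$ on $\psi$. It \emph{distinguishes} the members of $S$ if each outcome has nonzero probability for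 at most one member of $S$. \textbf{Theorem.} \begin{enumerate} \item Every UPB in $\mathbb C^3\otimes\mathbb C^3$ has exactly five members. \item A set of product states in $\mathbb C^3\otimes\mathbb C^3$ is a UPB if and only if its orthogonality graph is the pentagon graph. \item For every UPB $S$ in $\mathbb C^3\otimes\mathbb C^3$ there are unitaries $U,V$ on $\mathbb C^3$ and nondegenerate $p_A,p_B$ such that $(U\otimes V)S$ and $S(p_A,p_B)$ coincide up to phase factors of the members. \item For all angles, $S(p_A,p_B)$ is a UPB if and only if $p_A$ and $p_B$ are both nondegenerate. \item Every PB in $\mathbb C^3\otimes\mathbb C^3$ with six or more members is completable. \item The members of every UPB in $\mathbb C^3\otimes\mathbb C^3$ are distinguishable by a separable measurement. \end{enumerate} -/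

import Mathlib

open scoped TensorProduct

noncomputable section

/-- The Hilbert space of one party: a `d`-dimensional complex Hilbert space with standard
orthonormal basis `|0⟩, …, |d-1⟩`. -/
abbrev Qudit (d : ℕ) : Type := EuclideanSpace ℂ (Fin d)

/-- The bipartite Hilbert space `m ⊗ n`, with its tensor product inner product. -/
abbrev Bipartite (m n : ℕ) : Type := Qudit m ⊗[ℂ] Qudit n

/-- A (normalized) pure product state. -/
def IsProductState {m n : ℕ} (x : Bipartite m n) : Prop :=
  ∃ (a : Qudit m) (b : Qudit n), ‖a‖ = 1 ∧ ‖b‖ = 1 ∧ x = a ⊗ₜ[ℂ] b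

/-- An orthogonal product basis (PB): a set of mutually orthogonal pure product states. It spans
a subspace that may be proper. -/
def IsPB {m n : ℕ} (S : Set (Bipartite m n)) : Prop :=
  (∀ x ∈ S, IsProductState x) ∧ ∀ x ∈ S, ∀ y ∈ S, x ≠ y → inner ℂ x y = 0

/-- The complementary subspace: all vectors orthogonal to the span of `S`. -/
def complementarySubspace {m n : ℕ} (S : Set (Bipartite m n)) : Submodule ℂ (Bipartite m n) :=
  (Submodule.span ℂ S)ᗮ

/-- An uncompletable product basis (UCPB): the complementary subspace contains fewer mutually
orthogonal product states than its dimension. -/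
def IsUCPB {m n : ℕ} (S : Set (Bipartite m n)) : Prop :=
  IsPB S ∧ ∀ T : Set (Bipartite m n), IsPB T → (∀ x ∈ T, x ∈ complementarySubspace S) →
    T.ncard < Module.finrank ℂ (complementarySubspace S)

/-- An unextendible product basis (UPB): an uncompletable product basis whose complementary
subspace contains no product state. -/
def IsUPB {m n : ℕ} (S : Set (Bipartite m n)) : Prop :=
  IsUCPB S ∧ ∀ x ∈ complementarySubspace S, ¬ IsProductState x

/-- `S` can be completed to a full orthogonal product basis of `m ⊗ n`. -/
def IsCompletable {m n : ℕ} (S : Set (Bipartite m n)) : Prop :=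
  ∃ T : Set (Bipartite m n), S ⊆ T ∧ IsPB T ∧ Submodule.span ℂ T = ⊤

/-- The edges of one colour of an orthogonality graph: `k` and `l` are joined when the
corresponding local states of that party are orthogonal. -/
def localOrthogonalityGraph {ι : Type*} {d : ℕ} (a : ι → Qudit d)
    (ha : ∀ i, ‖a i‖ = 1) : SimpleGraph ι where
  Adj k l := inner ℂ (a k) (a l) = 0
  symm := ⟨fun _ _ h => inner_eq_zero_symm.mp h⟩
  loopless := ⟨fun k h => by
    have h0 : a k = 0 := inner_self_eq_zero.mp h
    have h1 := ha k
    rw [h0, norm_zero] at h1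
    exact zero_ne_one h1⟩

/-- The set `S` of product states `a i ⊗ b i`, enumerated without repetition by `ι`, has (for a
suitable labelling of its members) exactly the two-coloured orthogonality graph with edges `GA`
of Alice's colour and edges `GB` of Bob's colour. -/
def HasOrthogonalityGraph {ι : Type*} {m n : ℕ} (S : Set (Bipartite m n))
    (GA GB : SimpleGraph ι) : Prop :=
  ∃ (a : ι → Qudit m) (b : ι → Qudit n) (ha : ∀ i, ‖a i‖ = 1) (hb : ∀ i, ‖b i‖ = 1),
    Function.Injective (fun i => a i ⊗ₜ[ℂ] b i) ∧
    S = Set.range (fun i => a i ⊗ₜ[ℂ] b i) ∧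
    localOrthogonalityGraph a ha = GA ∧ localOrthogonalityGraph b hb = GB

/-- The pentagon orthogonality graph on five vertices: Alice's edges form the 5-cycle
`0-1-2-3-4-0`, and Bob's edges are exactly the remaining ones (the pentagram). -/
def HasPentagonGraph (S : Set (Bipartite 3 3)) : Prop :=
  HasOrthogonalityGraph S (SimpleGraph.cycleGraph 5) (SimpleGraph.cycleGraph 5)ᶜ

/-- The three angles of one party. -/
structure Angles where
  γ : ℝ
  θ : ℝ
  φ : ℝ

/-- The non-degeneracy condition on the angles of one party. -/
def Angles.Nondegenerate (p : Angles) : Prop :=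
  Real.cos p.θ ≠ 0 ∧ Real.cos p.γ ≠ 0 ∧ Real.sin p.θ ≠ 0 ∧ Real.sin p.γ ≠ 0

/-- The normalization `N = √(cos² γ + sin² γ cos² θ)`. -/
def Angles.N (p : Angles) : ℝ :=
  √(Real.cos p.γ ^ 2 + Real.sin p.γ ^ 2 * Real.cos p.θ ^ 2)

/-- Alice's five vectors, in coordinates with respect to `|0⟩, |1⟩, |2⟩`. -/
def aliceVector (p : Angles) : Fin 5 → Qudit 3 :=
  ![!₂[1, 0, 0],
    !₂[0, 1, 0],
    !₂[(Real.cos p.θ : ℂ), 0, (Real.sin p.θ : ℂ)],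
    !₂[(Real.sin p.γ : ℂ) * Real.sin p.θ,
      (Real.cos p.γ : ℂ) * Complex.exp (Complex.I * p.φ),
      -((Real.sin p.γ : ℂ) * Real.cos p.θ)],
    (1 / (p.N : ℂ)) • !₂[0,
      (Real.sin p.γ : ℂ) * Real.cos p.θ * Complex.exp (Complex.I * p.φ),
      (Real.cos p.γ : ℂ)]]

/-- Bob's five vectors, in coordinates with respect to `|0⟩, |1⟩, |2⟩`. -/
def bobVector (q : Angles) : Fin 5 → Qudit 3 :=
  ![!₂[0, 1, 0],
    !₂[(Real.sin q.γ : ℂ) * Real.sin q.θ,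
      (Real.cos q.γ : ℂ) * Complex.exp (Complex.I * q.φ),
      -((Real.sin q.γ : ℂ) * Real.cos q.θ)],
    !₂[1, 0, 0],
    !₂[(Real.cos q.θ : ℂ), 0, (Real.sin q.θ : ℂ)],
    (1 / (q.N : ℂ)) • !₂[0,
      (Real.sin q.γ : ℂ) * Real.cos q.θ * Complex.exp (Complex.I * q.φ),
      (Real.cos q.γ : ℂ)]]

/-- The member of the six-parameter family with angles `p` for Alice and `q` for Bob. -/
def sixParameterSet (p q : Angles) : Set (Bipartite 3 3) :=
  Set.range (fun i => aliceVector p i ⊗ₜ[ℂ] bobVector q i)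

/-- `S` and `T` consist of the same pure states: their members agree up to phase factors. -/
def SameStates {m n : ℕ} (S T : Set (Bipartite m n)) : Prop :=
  (∀ x ∈ S, ∃ y ∈ T, ∃ c : ℂ, ‖c‖ = 1 ∧ x = c • y) ∧
  (∀ y ∈ T, ∃ x ∈ S, ∃ c : ℂ, ‖c‖ = 1 ∧ x = c • y)

/-- `T` is obtained from `S` by a local unitary `U ⊗ V`, as a set of pure states. -/
def LocallyUnitarilyEquivalent {m n : ℕ} (S T : Set (Bipartite m n)) : Prop :=
  ∃ (U : Qudit m ≃ₗᵢ[ℂ] Qudit m) (V : Qudit n ≃ₗᵢ[ℂ] Qudit n),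
    SameStates
      (TensorProduct.map (U.toLinearEquiv : Qudit m →ₗ[ℂ] Qudit m)
        (V.toLinearEquiv : Qudit n →ₗ[ℂ] Qudit n) '' S) T

/-- A separable measurement on `m ⊗ n` with `numOutcomes` outcomes: for the outcome `k` the
operation elements are the product operators `A k i ⊗ B k i`, into some `m' ⊗ n'`, and all
operation elements together satisfy `∑ A†A ⊗ B†B = 1`. -/
structure SeparableMeasurement (m n : ℕ) where
  numOutcomes : ℕ
  numElements : Fin numOutcomes → ℕ
  m' : ℕ
  n' : ℕ
  A : (k : Fin numOutcomes) → Fin (numElements k) → (Qudit m →ₗ[ℂ] Qudit m')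
  B : (k : Fin numOutcomes) → Fin (numElements k) → (Qudit n →ₗ[ℂ] Qudit n')
  complete : ∑ k, ∑ i, TensorProduct.map ((A k i).adjoint ∘ₗ A k i) ((B k i).adjoint ∘ₗ B k i)
    = (LinearMap.id : Bipartite m n →ₗ[ℂ] Bipartite m n)

/-- The probability of outcome `k` on the pure state `x`. -/
def SeparableMeasurement.prob {m n : ℕ} (M : SeparableMeasurement m n)
    (k : Fin M.numOutcomes) (x : Bipartite m n) : ℝ :=
  ∑ i, ‖TensorProduct.map (M.A k i) (M.B k i) x‖ ^ 2

/-- The members of `S` are (perfectly) distinguishable by a separable measurement: an outcome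
that occurs with nonzero probability determines which member of `S` was given. -/
def IsSeparablyDistinguishable {m n : ℕ} (S : Set (Bipartite m n)) : Prop :=
  ∃ M : SeparableMeasurement m n, ∀ k, ∀ x ∈ S, ∀ y ∈ S,
    M.prob k x ≠ 0 → M.prob k y ≠ 0 → x = y

end

/-! The carrying fact is `IsPB.span_eq_top_of_hasTriangle`: a product basis of two qutrits that no
product state extends, and in which three members have mutually orthogonal states of one party,
already spans the whole space. By duality it is enough that a bilinear form Φ vanishing on all
members is zero (`IsUnextendibleTriangle.form_eq_zero`). With e the orthonormal basis formed by the
three local states, unextendibility is applied to suitably built product vectors and forces Φ to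
vanish at e i ⊗ y for every y. The construction fails only for a pair of states overlapping a common
e i whose other factors are neither orthogonal nor parallel. Such a pair forces some of the partners
b i to be parallel, and this gives the freedom to rotate e until no such pair remains.

Hence a product basis with a triangle is completable, since a maximal extension of it spans, and a
UPB has no triangle. Ramsey's R(3,3) = 6 gives a triangle among any six members, while at most four
members always leave an orthogonal product state. So a UPB has five members, and the only
triangle-free two-colouring of K₅ is the pentagon with its pentagram. Conversely, any three vectors
of a pentagon in ℂ³ are independent. A product state orthogonal to all five members would have a
factor orthogonal to three of the corresponding local states, hence zero.

The normal form comes from an orthonormal frame adapted to the first three vectors of a pentagon.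
Degenerate angles are exactly those that create a triangle or a zero vector.

For the measurement, dropping member k leaves a completable set, so 1 - ∑_{i≠k} P_i is a sum of
product projectors, where P_i is the projector onto member i. Averaging over k and adding (4/5) P_k
to outcome k gives the identity. -/

/-! ### Orthogonality in ℂ³ -/

/-- Two vectors of a qutrit always have a common orthogonal unit vector. -/
theorem exists_unit_orthogonal_pair (u v : Qudit 3) :
    ∃ x : Qudit 3, ‖x‖ = 1 ∧ inner ℂ x u = 0 ∧ inner ℂ x v = 0 := by
  have hlt : Module.finrank ℂ (Submodule.span ℂ ({u, v} : Set (Qudit 3))) ≤ 2 := by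
    classical
    have h1 := finrank_span_finset_le_card (R := ℂ) ({u, v} : Finset (Qudit 3))
    rw [Finset.coe_pair] at h1
    exact h1.trans Finset.card_le_two
  have hne : Submodule.span ℂ ({u, v} : Set (Qudit 3)) ≠ ⊤ := by
    intro h
    rw [h, finrank_top, finrank_euclideanSpace_fin] at hlt
    omega
  have hne' : (Submodule.span ℂ ({u, v} : Set (Qudit 3)))ᗮ ≠ ⊥ := by
    rwa [Ne, Submodule.orthogonal_eq_bot_iff]
  obtain ⟨x, hx, hx0⟩ := Submodule.exists_mem_ne_zero_of_ne_bot hne'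
  have h : ∀ w ∈ ({u, v} : Set (Qudit 3)), inner ℂ x w = 0 := fun w hw =>
    Submodule.inner_left_of_mem_orthogonal (Submodule.subset_span hw) hx
  refine ⟨(‖x‖⁻¹ : ℂ) • x, ?_, ?_, ?_⟩
  · rw [norm_smul, norm_inv, Complex.norm_real, norm_norm, inv_mul_cancel₀ (norm_ne_zero_iff.2 hx0)]
  · rw [inner_smul_left, h u (by simp), mul_zero]
  · rw [inner_smul_left, h v (by simp), mul_zero]

/-- In ℂ³ the common orthogonal complement of two independent vectors is a line. This is the source
of every parallelism claim below. -/
theorem mem_span_of_orthogonal_pair {u v x y : Qudit 3} (hu : u ≠ 0)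
    (hv : v ∉ Submodule.span ℂ {u}) (hux : inner ℂ u x = 0) (hvx : inner ℂ v x = 0)
    (huy : inner ℂ u y = 0) (hvy : inner ℂ v y = 0) (hx : x ≠ 0) :
    y ∈ Submodule.span ℂ {x} := by
  have hli : LinearIndependent ℂ ![u, v] := by
    rw [LinearIndependent.pair_iff' hu]
    intro a ha
    exact hv (Submodule.mem_span_singleton.2 ⟨a, ha⟩)
  have h2 : Module.finrank ℂ (Submodule.span ℂ (Set.range ![u, v])) = 2 := by
    simpa using finrank_span_eq_card hli
  have h3 := (Submodule.span ℂ (Set.range ![u, v])).finrank_add_finrank_orthogonal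
  rw [h2, finrank_euclideanSpace_fin] at h3
  have h1 : Module.finrank ℂ (Submodule.span ℂ (Set.range ![u, v]))ᗮ = 1 := by omega
  have hmem : ∀ z : Qudit 3, inner ℂ u z = 0 → inner ℂ v z = 0 →
      z ∈ (Submodule.span ℂ (Set.range ![u, v]))ᗮ := by
    intro z hz hz'
    rw [Submodule.mem_orthogonal]
    intro w hw
    induction hw using Submodule.span_induction with
    | mem w hw =>
      obtain ⟨i, rfl⟩ := hw
      fin_cases i <;> simpa
    | zero => simp
    | add p q _ _ hp hq => rw [inner_add_left, hp, hq, add_zero]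
    | smul c p _ hp => rw [inner_smul_left, hp, mul_zero]
  obtain ⟨c, hc⟩ := (finrank_eq_one_iff_of_nonzero'
    (⟨x, hmem x hux hvx⟩ : (Submodule.span ℂ (Set.range ![u, v]))ᗮ)
    (by simpa [Subtype.ext_iff] using hx)).1 h1 ⟨y, hmem y huy hvy⟩
  exact Submodule.mem_span_singleton.2 ⟨c, by simpa [Subtype.ext_iff] using hc⟩

theorem notMem_span_of_orthogonal {u v : Qudit 3} (hv : v ≠ 0) (h : inner ℂ u v = 0) :
    v ∉ Submodule.span ℂ {u} := by
  intro hmem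
  obtain ⟨c, rfl⟩ := Submodule.mem_span_singleton.1 hmem
  rw [inner_smul_right, mul_eq_zero] at h
  rcases h with rfl | h
  · simp at hv
  · rw [inner_self_eq_zero] at h
    simp [h] at hv

/-- An orthonormal pair of a qutrit can be completed, filling the slots `0` and `2`. -/
theorem exists_orthonormalBasis_extending_pair {u v : Qudit 3} (hu : ‖u‖ = 1) (hv : ‖v‖ = 1)
    (huv : inner ℂ u v = 0) :
    ∃ e : OrthonormalBasis (Fin 3) ℂ (Qudit 3), e 0 = u ∧ e 2 = v := by
  -- The middle entry is a filler; only the slots 0 and 2 are prescribed.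
  have hon : Orthonormal ℂ (({0, 2} : Set (Fin 3)).domRestrict ![u, u, v]) := by
    constructor
    · rintro ⟨i, rfl | rfl⟩
      · exact hu
      · exact hv
    · rintro ⟨i, rfl | rfl⟩ ⟨j, rfl | rfl⟩ hij
      · exact absurd rfl hij
      · exact huv
      · exact inner_eq_zero_symm.1 huv
      · exact absurd rfl hij
  obtain ⟨e, he⟩ := hon.exists_orthonormalBasis_extension_of_card_eq (by simp)
  exact ⟨e, he 0 (by simp), he 2 (by simp)⟩

/-- If two vectors are orthogonal and share a coordinate, then they share another one. -/
theorem OrthonormalBasis.exists_ne_inner_ne_zero {ι E : Type*} [Fintype ι]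
    [NormedAddCommGroup E]
    [InnerProductSpace ℂ E] (e : OrthonormalBasis ι ℂ E) {x y : E} (hxy : inner ℂ x y = 0)
    {i : ι} (hx : inner ℂ (e i) x ≠ 0) (hy : inner ℂ (e i) y ≠ 0) :
    ∃ k, k ≠ i ∧ inner ℂ (e k) x ≠ 0 ∧ inner ℂ (e k) y ≠ 0 := by
  by_contra! h
  rw [← e.sum_inner_mul_inner x y, Finset.sum_eq_single i] at hxy
  · rcases mul_eq_zero.1 hxy with h1 | h1
    · exact hx (inner_eq_zero_symm.1 h1)
    · exact hy h1
  · intro k _ hk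
    by_cases h1 : inner ℂ (e k) x = 0
    · rw [inner_eq_zero_symm.1 h1, zero_mul]
    · rw [h k hk h1, mul_zero]
  · simp

/-! ### Bilinear forms vanishing on an unextendible product basis with a triangle -/

/-- A product basis consisting of the states `e i ⊗ b i`, for an orthonormal basis `e`, and of
further states `α j ⊗ β j`, which cannot be extended by a product state, together with a bilinear
form that vanishes on all its members. -/
structure IsUnextendibleTriangle {ι : Type*} (e : OrthonormalBasis (Fin 3) ℂ (Qudit 3))
    (b : Fin 3 → Qudit 3) (α β : ι → Qudit 3) (Φ : Qudit 3 →ₗ[ℂ] Qudit 3 →ₗ[ℂ] ℂ) : Prop where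
  b_ne : ∀ i, b i ≠ 0
  α_norm : ∀ j, ‖α j‖ = 1
  β_ne : ∀ j, β j ≠ 0
  cross : ∀ i j, inner ℂ (e i) (α j) = 0 ∨ inner ℂ (b i) (β j) = 0
  pair : ∀ j l, j ≠ l → inner ℂ (α j) (α l) = 0 ∨ inner ℂ (β j) (β l) = 0
  unext : ∀ x y : Qudit 3, x ≠ 0 → y ≠ 0 →
    (∃ i, inner ℂ x (e i) ≠ 0 ∧ inner ℂ y (b i) ≠ 0) ∨
    (∃ j, inner ℂ x (α j) ≠ 0 ∧ inner ℂ y (β j) ≠ 0)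
  form_b : ∀ i, Φ (e i) (b i) = 0
  form_β : ∀ j, Φ (α j) (β j) = 0

namespace IsUnextendibleTriangle

variable {ι : Type*} {e : OrthonormalBasis (Fin 3) ℂ (Qudit 3)} {b : Fin 3 → Qudit 3}
  {α β : ι → Qudit 3} {Φ : Qudit 3 →ₗ[ℂ] Qudit 3 →ₗ[ℂ] ℂ}

theorem inner_b_of_ne (h : IsUnextendibleTriangle e b α β Φ) {i : Fin 3} {j : ι}
    (hij : inner ℂ (e i) (α j) ≠ 0) : inner ℂ (b i) (β j) = 0 :=
  (h.cross i j).resolve_left hij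

/-- Let P be spanned by the α l whose partner β l is parallel to β j. The form Φ(·, β j) vanishes on
P, so if it did not vanish at e i, the component x of e i orthogonal to P would be nonzero. Then x ⊗
β j would be orthogonal to every member, against unextendibility: a member whose second factor is
neither orthogonal nor parallel to β j has its first factor in Pᗮ, where pairing with x equals
pairing with e i. -/
theorem form_apply_eq_zero (h : IsUnextendibleTriangle e b α β Φ) {i : Fin 3} {j : ι}
    (hij : inner ℂ (e i) (α j) ≠ 0)
    (hgood : ∀ l, inner ℂ (e i) (α l) ≠ 0 →
      inner ℂ (β j) (β l) = 0 ∨ β l ∈ Submodule.span ℂ {β j}) :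
    Φ (e i) (β j) = 0 := by
  by_contra hne
  set P : Submodule ℂ (Qudit 3) :=
    Submodule.span ℂ (α '' {l | β l ∈ Submodule.span ℂ {β j}}) with hP
  have hPker : P ≤ LinearMap.ker (Φ.flip (β j)) := by
    rw [hP, Submodule.span_le]
    rintro _ ⟨l, hl, rfl⟩
    obtain ⟨c, hc⟩ := Submodule.mem_span_singleton.1 hl
    have hc0 : c ≠ 0 := by
      rintro rfl
      exact h.β_ne l (by simpa using hc.symm)
    have := h.form_β l
    rw [← hc, map_smul, smul_eq_mul, mul_eq_zero] at this
    simpa using this.resolve_left hc0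
  have horth : ∀ z : Qudit 3, (∀ l, β l ∈ Submodule.span ℂ {β j} → inner ℂ (α l) z = 0) →
      z ∈ Pᗮ := by
    intro z hz
    rw [Submodule.mem_orthogonal]
    intro w hw
    induction hw using Submodule.span_induction with
    | mem w hw =>
      obtain ⟨l, hl, rfl⟩ := hw
      exact hz l hl
    | zero => simp
    | add p q _ _ hp hq => rw [inner_add_left, hp, hq, add_zero]
    | smul c p _ hp => rw [inner_smul_left, hp, mul_zero]
  set q : Qudit 3 := P.starProjection (e i) with hq
  have hqP : q ∈ P := Submodule.starProjection_apply_mem _ _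
  have hxP : e i - q ∈ Pᗮ := Submodule.sub_starProjection_mem_orthogonal _
  have hx : e i - q ≠ 0 := by
    intro h0
    rw [sub_eq_zero] at h0
    rw [← h0] at hqP
    exact hne (by simpa using hPker hqP)
  -- Passing from e i to its component outside P does not change inner products with vectors of Pᗮ.
  have hstep : ∀ z ∈ Pᗮ, inner ℂ (e i - q) z = inner ℂ (e i) z := by
    intro z hz
    rw [inner_sub_left, Submodule.inner_right_of_mem_orthogonal hqP hz, sub_zero]
  have hcoef : ∀ l, β l ∈ Submodule.span ℂ {β j} → ∀ z, inner ℂ (β l) z = 0 →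
      inner ℂ (β j) z = 0 := by
    intro l hl z hz
    obtain ⟨c, hc⟩ := Submodule.mem_span_singleton.1 hl
    have hc0 : c ≠ 0 := by
      rintro rfl
      exact h.β_ne l (by simpa using hc.symm)
    rw [← hc, inner_smul_left, mul_eq_zero] at hz
    exact hz.resolve_left (by simpa using hc0)
  rcases h.unext _ _ hx (h.β_ne j) with ⟨i', h1, h2⟩ | ⟨l, h1, h2⟩
  · have hi' : i' ≠ i := by
      rintro rfl
      exact h2 (inner_eq_zero_symm.1 (h.inner_b_of_ne hij))
    apply h1
    rw [hstep, e.orthonormal.2 hi'.symm]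
    apply horth
    intro l hl
    rcases h.cross i' l with h3 | h3
    · exact inner_eq_zero_symm.1 h3
    · exact absurd (hcoef l hl _ (inner_eq_zero_symm.1 h3)) h2
  · by_cases hl : β l ∈ Submodule.span ℂ {β j}
    · exact h1 (Submodule.inner_left_of_mem_orthogonal
        (Submodule.subset_span (Set.mem_image_of_mem α hl)) hxP)
    · rw [hstep] at h1
      · rcases hgood l h1 with h3 | h3
        · exact h2 h3
        · exact hl h3
      · apply horth
        intro m hm
        have hml : m ≠ l := by
          rintro rfl
          exact hl hm
        exact (h.pair m l hml).resolve_right fun h3 => h2 (hcoef m hm _ h3)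

/-- The kernel of Φ(e i, ·) contains b i and every β j whose α j overlaps e i. A nonzero y
orthogonal to this kernel would make e i ⊗ y orthogonal to all members. -/
theorem form_eq_zero_of_good (h : IsUnextendibleTriangle e b α β Φ)
    (hgood : ∀ i j l, inner ℂ (e i) (α j) ≠ 0 → inner ℂ (e i) (α l) ≠ 0 →
      inner ℂ (β j) (β l) = 0 ∨ β l ∈ Submodule.span ℂ {β j}) : Φ = 0 := by
  refine e.toBasis.ext fun i => ?_
  rw [OrthonormalBasis.coe_toBasis, LinearMap.zero_apply, ← LinearMap.ker_eq_top]
  by_contra hne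
  rw [← Submodule.orthogonal_eq_bot_iff] at hne
  obtain ⟨y, hy, hy0⟩ := Submodule.exists_mem_ne_zero_of_ne_bot hne
  rcases h.unext (e i) y (e.orthonormal.ne_zero i) hy0 with ⟨k, h1, h2⟩ | ⟨j, h1, h2⟩
  · have hk : i = k := by
      by_contra hik
      exact h1 (e.orthonormal.2 hik)
    subst hk
    exact h2 (Submodule.inner_left_of_mem_orthogonal (LinearMap.mem_ker.2 (h.form_b i)) hy)
  · exact h2 (Submodule.inner_left_of_mem_orthogonal
      (LinearMap.mem_ker.2 (h.form_apply_eq_zero h1 fun l => hgood i j l h1)) hy)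

/-- It suffices to exclude pairs of states that share two coordinates. -/
theorem form_eq_zero_of_shared (h : IsUnextendibleTriangle e b α β Φ)
    (hgood : ∀ i k j l, i < k → inner ℂ (e i) (α j) ≠ 0 → inner ℂ (e i) (α l) ≠ 0 →
      inner ℂ (e k) (α j) ≠ 0 → inner ℂ (e k) (α l) ≠ 0 →
      inner ℂ (β j) (β l) = 0 ∨ β l ∈ Submodule.span ℂ {β j}) : Φ = 0 := by
  refine h.form_eq_zero_of_good fun i j l hj hl => ?_
  by_cases hjl : j = l
  · subst hjl
    exact Or.inr (Submodule.mem_span_singleton_self _)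
  rcases h.pair j l hjl with h1 | h1
  · obtain ⟨k, hk, hkj, hkl⟩ := e.exists_ne_inner_ne_zero h1 hj hl
    rcases lt_or_gt_of_ne hk with hlt | hlt
    · exact hgood k i j l hlt hkj hkl hj hl
    · exact hgood i k j l hlt hj hl hkj hkl
  · exact Or.inl h1

end IsUnextendibleTriangle

theorem OrthonormalBasis.exists_inner_ne_zero_of_inner_ne_zero {ι E : Type*} [Fintype ι]
    [NormedAddCommGroup E] [InnerProductSpace ℂ E] (e : OrthonormalBasis ι ℂ E) {x y : E}
    (hxy : inner ℂ x y ≠ 0) : ∃ i, inner ℂ (e i) x ≠ 0 ∧ inner ℂ (e i) y ≠ 0 := by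
  by_contra! h
  apply hxy
  rw [← e.sum_inner_mul_inner x y]
  refine Finset.sum_eq_zero fun i _ => ?_
  by_cases h1 : inner ℂ (e i) x = 0
  · rw [inner_eq_zero_symm.1 h1, zero_mul]
  · rw [h i h1, mul_zero]

theorem mem_span_singleton_symm {E : Type*} [AddCommGroup E] [Module ℂ E] {x y : E} (hy : y ≠ 0)
    (h : y ∈ Submodule.span ℂ {x}) : x ∈ Submodule.span ℂ {y} := by
  obtain ⟨c, rfl⟩ := Submodule.mem_span_singleton.1 h
  have hc : c ≠ 0 := by
    rintro rfl
    simp at hy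
  exact Submodule.mem_span_singleton.2 ⟨c⁻¹, by rw [smul_smul, inv_mul_cancel₀ hc, one_smul]⟩

theorem inner_eq_zero_of_mem_span_singleton {E : Type*} [NormedAddCommGroup E]
    [InnerProductSpace ℂ E] {x y z : E} (h : y ∈ Submodule.span ℂ {x}) (hz : inner ℂ x z = 0) :
    inner ℂ y z = 0 := by
  obtain ⟨c, rfl⟩ := Submodule.mem_span_singleton.1 h
  rw [inner_smul_left, hz, mul_zero]

namespace IsUnextendibleTriangle

variable {ι : Type*} {e : OrthonormalBasis (Fin 3) ℂ (Qudit 3)} {b : Fin 3 → Qudit 3}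
  {α β : ι → Qudit 3} {Φ : Qudit 3 →ₗ[ℂ] Qudit 3 →ₗ[ℂ] ℂ}

theorem reindex (h : IsUnextendibleTriangle e b α β Φ) (σ : Equiv.Perm (Fin 3)) :
    IsUnextendibleTriangle (e.reindex σ.symm) (b ∘ σ) α β Φ where
  b_ne i := h.b_ne _
  α_norm := h.α_norm
  β_ne := h.β_ne
  cross i j := by simpa using h.cross (σ i) j
  pair := h.pair
  unext x y hx hy := by
    refine (h.unext x y hx hy).imp_left ?_
    rintro ⟨i, hi⟩
    exact ⟨σ.symm i, by simpa using hi⟩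
  form_b i := by simpa using h.form_b (σ i)
  form_β := h.form_β

/-- Only those e i with parallel b i are mixed, so each new e' k ⊗ b k is a combination of the old e
i ⊗ b i, and conversely. Orthogonality to the triangle and vanishing of Φ on it are therefore
preserved. -/
theorem change_basis (h : IsUnextendibleTriangle e b α β Φ)
    (e' : OrthonormalBasis (Fin 3) ℂ (Qudit 3))
    (he : ∀ i k, inner ℂ (e i) (e' k) ≠ 0 → b k ∈ Submodule.span ℂ {b i}) :
    IsUnextendibleTriangle e' b α β Φ where
  b_ne := h.b_ne
  α_norm := h.α_norm
  β_ne := h.β_ne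
  cross k j := by
    by_cases h1 : inner ℂ (e' k) (α j) = 0
    · exact Or.inl h1
    · obtain ⟨i, h2, h3⟩ := e.exists_inner_ne_zero_of_inner_ne_zero h1
      exact Or.inr (inner_eq_zero_of_mem_span_singleton (he i k h2) (h.inner_b_of_ne h3))
  pair := h.pair
  unext x y hx hy := by
    refine (h.unext x y hx hy).imp_left ?_
    rintro ⟨i, h1, h2⟩
    obtain ⟨k, h3, h4⟩ := e'.exists_inner_ne_zero_of_inner_ne_zero h1
    refine ⟨k, fun h5 => h3 (inner_eq_zero_symm.1 h5), fun h5 => h2 ?_⟩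
    exact inner_eq_zero_symm.1 (inner_eq_zero_of_mem_span_singleton
      (mem_span_singleton_symm (h.b_ne k) (he i k fun h6 => h4 (inner_eq_zero_symm.1 h6)))
      (inner_eq_zero_symm.1 h5))
  form_b k := by
    rw [← e.sum_repr' (e' k), map_sum, LinearMap.sum_apply]
    refine Finset.sum_eq_zero fun i _ => ?_
    rw [map_smul, LinearMap.smul_apply]
    by_cases h1 : inner ℂ (e i) (e' k) = 0
    · rw [h1, zero_smul]
    · obtain ⟨c, hc⟩ := Submodule.mem_span_singleton.1 (he i k h1)
      rw [← hc, map_smul, h.form_b, smul_zero, smul_zero]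
  form_β := h.form_β

/-- When e i is itself some α j, every other β r whose α r overlaps e i is orthogonal to both b i
and β j. These two are orthogonal to each other, so all such β r lie on one line. -/
theorem good_of_eq (h : IsUnextendibleTriangle e b α β Φ) {i : Fin 3} {j : ι}
    (hij : e i = α j) {s t : ι} (hs : inner ℂ (e i) (α s) ≠ 0) (ht : inner ℂ (e i) (α t) ≠ 0) :
    inner ℂ (β s) (β t) = 0 ∨ β t ∈ Submodule.span ℂ {β s} := by
  have hbj : inner ℂ (b i) (β j) = 0 := by
    apply h.inner_b_of_ne
    rw [← hij, inner_self_ne_zero]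
    exact e.orthonormal.ne_zero i
  have key : ∀ r, inner ℂ (e i) (α r) ≠ 0 → r ≠ j → inner ℂ (β j) (β r) = 0 := by
    intro r hr hrj
    rw [hij] at hr
    exact (h.pair j r hrj.symm).resolve_left hr
  by_cases hsj : s = j
  · subst hsj
    by_cases hts : t = s
    · rw [hts]
      exact Or.inr (Submodule.mem_span_singleton_self _)
    · exact Or.inl (key t ht hts)
  by_cases htj : t = j
  · subst htj
    exact Or.inl (inner_eq_zero_symm.1 (key s hs hsj))
  · exact Or.inr (mem_span_of_orthogonal_pair (h.b_ne i)
      (notMem_span_of_orthogonal (h.β_ne j) hbj) (h.inner_b_of_ne hs) (key s hs hsj)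
      (h.inner_b_of_ne ht) (key t ht htj) (h.β_ne s))

/-- With all b i parallel the basis is arbitrary, so α j and α l can be placed in slots 0 and 2. Any
two of the three slots include one of these, and there `good_of_eq` applies. -/
theorem form_eq_zero_of_parallel (h : IsUnextendibleTriangle e b α β Φ)
    (hb : ∀ i k, b k ∈ Submodule.span ℂ {b i}) {j l : ι} (hjl : inner ℂ (α j) (α l) = 0) :
    Φ = 0 := by
  obtain ⟨e', h0, h2⟩ := exists_orthonormalBasis_extending_pair (h.α_norm j) (h.α_norm l) hjl
  have h' := h.change_basis e' fun i k _ => hb i k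
  refine h'.form_eq_zero_of_shared fun i k s t hik his hit hks hkt => ?_
  have hcase : i = 0 ∨ k = 2 := by omega
  rcases hcase with rfl | rfl
  · exact h'.good_of_eq h0 his hit
  · exact h'.good_of_eq h2 hks hkt

/-- The plane of e 0 and e 1 may be rotated freely, and α j lies in it, so α j becomes slot 0 while
e 2 stays. Two shared slots either include 0, where `good_of_eq` applies, or are 1 and 2. In the
latter case both second factors are orthogonal to the independent b 1 and b 2, hence parallel. -/
theorem form_eq_zero_of_not_parallel (h : IsUnextendibleTriangle e b α β Φ)
    (h01 : b 1 ∈ Submodule.span ℂ {b 0}) (h02 : b 2 ∉ Submodule.span ℂ {b 0}) {j : ι}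
    (hj : inner ℂ (e 2) (α j) = 0) : Φ = 0 := by
  obtain ⟨e', h0, h2⟩ := exists_orthonormalBasis_extending_pair (h.α_norm j)
    (e.orthonormal.1 2) (inner_eq_zero_symm.1 hj)
  have h12 : b 2 ∉ Submodule.span ℂ {b 1} := fun hmem =>
    h02 ((Submodule.span_singleton_le_iff_mem _ _).2 h01 hmem)
  have h' := h.change_basis e' fun i k hik => by
    by_cases hi : i = 2
    · subst hi
      by_cases hk : k = 2
      · rw [hk]
        exact Submodule.mem_span_singleton_self _
      · rw [← h2] at hik
        exact absurd (e'.orthonormal.2 (Ne.symm hk)) hik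
    · by_cases hk : k = 2
      · subst hk
        rw [h2] at hik
        exact absurd (e.orthonormal.2 hi) hik
      · have hi' : i = 0 ∨ i = 1 := by omega
        have hk' : k = 0 ∨ k = 1 := by omega
        rcases hi' with rfl | rfl <;> rcases hk' with rfl | rfl
        · exact Submodule.mem_span_singleton_self _
        · exact h01
        · exact mem_span_singleton_symm (h.b_ne 1) h01
        · exact Submodule.mem_span_singleton_self _
  refine h'.form_eq_zero_of_shared fun i k s t hik his hit hks hkt => ?_
  have hcase : i = 0 ∨ (i = 1 ∧ k = 2) := by omega
  rcases hcase with rfl | ⟨rfl, rfl⟩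
  · exact h'.good_of_eq h0 his hit
  · exact Or.inr (mem_span_of_orthogonal_pair (h.b_ne 1) h12 (h'.inner_b_of_ne his)
      (h'.inner_b_of_ne hks) (h'.inner_b_of_ne hit) (h'.inner_b_of_ne hkt) (h.β_ne s))

/-- If e i overlaps both α j and α l, then b i lies on the line orthogonal to the independent β j
and β l. Thus b 0 and b 1 are parallel. If b 2 is not parallel to them, then e 2 misses α j or α l.
Each alternative is a case already settled by rotating the basis. -/
theorem form_eq_zero_of_bad (h : IsUnextendibleTriangle e b α β Φ) {j l : ι}
    (h0j : inner ℂ (e 0) (α j) ≠ 0) (h0l : inner ℂ (e 0) (α l) ≠ 0)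
    (h1j : inner ℂ (e 1) (α j) ≠ 0) (h1l : inner ℂ (e 1) (α l) ≠ 0)
    (hjl : inner ℂ (β j) (β l) ≠ 0) (hpar : β l ∉ Submodule.span ℂ {β j}) : Φ = 0 := by
  have hne : j ≠ l := by
    rintro rfl
    exact hpar (Submodule.mem_span_singleton_self _)
  have hα : inner ℂ (α j) (α l) = 0 := (h.pair j l hne).resolve_right hjl
  have hb : ∀ i k, inner ℂ (e i) (α j) ≠ 0 → inner ℂ (e i) (α l) ≠ 0 →
      inner ℂ (e k) (α j) ≠ 0 → inner ℂ (e k) (α l) ≠ 0 → b k ∈ Submodule.span ℂ {b i} := by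
    intro i k hij hil hkj hkl
    exact mem_span_of_orthogonal_pair (h.β_ne j) hpar (inner_eq_zero_symm.1 (h.inner_b_of_ne hij))
      (inner_eq_zero_symm.1 (h.inner_b_of_ne hil)) (inner_eq_zero_symm.1 (h.inner_b_of_ne hkj))
      (inner_eq_zero_symm.1 (h.inner_b_of_ne hkl)) (h.b_ne i)
  have h01 := hb 0 1 h0j h0l h1j h1l
  by_cases h02 : b 2 ∈ Submodule.span ℂ {b 0}
  · have hall : ∀ i, b i ∈ Submodule.span ℂ {b 0} := by
      intro i
      fin_cases i
      · exact Submodule.mem_span_singleton_self _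
      · exact h01
      · exact h02
    exact h.form_eq_zero_of_parallel (fun i k =>
      (Submodule.span_singleton_le_iff_mem _ _).2
        (mem_span_singleton_symm (h.b_ne i) (hall i)) (hall k)) hα
  · by_cases h2j : inner ℂ (e 2) (α j) = 0
    · exact h.form_eq_zero_of_not_parallel h01 h02 h2j
    · by_cases h2l : inner ℂ (e 2) (α l) = 0
      · exact h.form_eq_zero_of_not_parallel h01 h02 h2l
      · exact absurd (hb 0 2 h0j h0l h2j h2l) h02

theorem form_eq_zero (h : IsUnextendibleTriangle e b α β Φ) : Φ = 0 := by
  by_cases hgood : ∀ i j l, inner ℂ (e i) (α j) ≠ 0 → inner ℂ (e i) (α l) ≠ 0 →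
      inner ℂ (β j) (β l) = 0 ∨ β l ∈ Submodule.span ℂ {β j}
  · exact h.form_eq_zero_of_good hgood
  push Not at hgood
  obtain ⟨i, j, l, hij, hil, hjl, hpar⟩ := hgood
  have hne : j ≠ l := by
    rintro rfl
    exact hpar (Submodule.mem_span_singleton_self _)
  obtain ⟨k, hk, hkj, hkl⟩ :=
    e.exists_ne_inner_ne_zero ((h.pair j l hne).resolve_right hjl) hij hil
  have hperm : ∀ i k : Fin 3, k ≠ i → ∃ σ : Equiv.Perm (Fin 3), σ 0 = i ∧ σ 1 = k := by decide
  obtain ⟨σ, rfl, rfl⟩ := hperm i k hk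
  exact (h.reindex σ).form_eq_zero_of_bad (by simpa using hij) (by simpa using hil)
    (by simpa using hkj) (by simpa using hkl) hjl hpar

end IsUnextendibleTriangle

/-- The three local states of the triangle become the basis e, and all remaining members are indexed
by the complement of the range of t. -/
theorem form_eq_zero_of_orthonormal_left {ι : Type*} {α β : ι → Qudit 3}
    (hα : ∀ j, ‖α j‖ = 1) (hβ : ∀ j, ‖β j‖ = 1)
    (hpair : ∀ j l, j ≠ l → inner ℂ (α j) (α l) = 0 ∨ inner ℂ (β j) (β l) = 0)
    {t : Fin 3 → ι} (ht : Orthonormal ℂ (α ∘ t))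
    (hU : ∀ x y : Qudit 3, x ≠ 0 → y ≠ 0 → ∃ j, inner ℂ x (α j) ≠ 0 ∧ inner ℂ y (β j) ≠ 0)
    {Φ : Qudit 3 →ₗ[ℂ] Qudit 3 →ₗ[ℂ] ℂ} (hΦ : ∀ j, Φ (α j) (β j) = 0) : Φ = 0 := by
  have ht' : Orthonormal ℂ ((Set.univ : Set (Fin 3)).domRestrict (α ∘ t)) :=
    ht.comp _ Subtype.val_injective
  obtain ⟨e, he⟩ := ht'.exists_orthonormalBasis_extension_of_card_eq (by simp)
  replace he : ∀ i, e i = α (t i) := fun i => he i (Set.mem_univ i)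
  have hβ0 : ∀ j, β j ≠ 0 := fun j h0 => by simpa [h0] using hβ j
  have h : IsUnextendibleTriangle e (β ∘ t)
      (fun j : {j // j ∉ Set.range t} => α j) (fun j => β j) Φ :=
    { b_ne := fun i => hβ0 _
      α_norm := fun j => hα j
      β_ne := fun j => hβ0 j
      cross := fun i j => by
        rw [he]
        exact hpair _ _ fun h => j.2 ⟨i, h⟩
      pair := fun j l hjl => hpair j l fun h => hjl (Subtype.ext h)
      unext := fun x y hx hy => by
        obtain ⟨j, hj⟩ := hU x y hx hy
        by_cases hjt : j ∈ Set.range t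
        · obtain ⟨i, rfl⟩ := hjt
          exact Or.inl ⟨i, by rwa [he]⟩
        · exact Or.inr ⟨⟨j, hjt⟩, hj⟩
      form_b := fun i => by
        rw [he]
        exact hΦ (t i)
      form_β := fun j => hΦ j }
  exact h.form_eq_zero

/-! ### Product states, unextendibility and completion -/

/-- Contract the second factor with b. This recovers a local state from a product state up to a
scalar. -/
theorem tmul_left_eq_smul {m n : ℕ} {a a' : Qudit m} {b b' : Qudit n} (hb : ‖b‖ = 1)
    (h : a ⊗ₜ[ℂ] b = a' ⊗ₜ[ℂ] b') : a = inner ℂ b b' • a' := by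
  have := congrArg (TensorProduct.rid ℂ (Qudit m) ∘
    TensorProduct.map LinearMap.id (innerSL ℂ b : Qudit n →ₗ[ℂ] ℂ)) h
  simpa [inner_self_eq_norm_sq_to_K, hb] using this

theorem tmul_right_eq_smul {m n : ℕ} {a a' : Qudit m} {b b' : Qudit n} (ha : ‖a‖ = 1)
    (h : a ⊗ₜ[ℂ] b = a' ⊗ₜ[ℂ] b') : b = inner ℂ a a' • b' := by
  have := congrArg (TensorProduct.lid ℂ (Qudit n) ∘
    TensorProduct.map (innerSL ℂ a : Qudit m →ₗ[ℂ] ℂ) LinearMap.id) h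
  simpa [inner_self_eq_norm_sq_to_K, ha] using this

theorem mem_complementarySubspace {m n : ℕ} {S : Set (Bipartite m n)} {z : Bipartite m n} :
    z ∈ complementarySubspace S ↔ ∀ x ∈ S, inner ℂ x z = 0 := by
  refine ⟨fun h x hx => Submodule.inner_right_of_mem_orthogonal (Submodule.subset_span hx) h,
    fun h => ?_⟩
  rw [complementarySubspace, Submodule.mem_orthogonal]
  intro w hw
  induction hw using Submodule.span_induction with
  | mem w hw => exact h w hw
  | zero => simp
  | add p q _ _ hp hq => rw [inner_add_left, hp, hq, add_zero]
  | smul c p _ hp => rw [inner_smul_left, hp, mul_zero]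

theorem IsProductState.norm_eq_one {m n : ℕ} {x : Bipartite m n} (hx : IsProductState x) :
    ‖x‖ = 1 := by
  obtain ⟨a, b, ha, hb, rfl⟩ := hx
  rw [TensorProduct.norm_tmul, ha, hb, one_mul]

theorem IsProductState.ne_zero {m n : ℕ} {x : Bipartite m n} (hx : IsProductState x) :
    x ≠ 0 := by
  rintro rfl
  simpa using hx.norm_eq_one

theorem isProductState_tmul_normalize {m n : ℕ} {a : Qudit m} {b : Qudit n} (ha : a ≠ 0)
    (hb : b ≠ 0) : IsProductState (((‖a‖⁻¹ : ℂ) • a) ⊗ₜ[ℂ] ((‖b‖⁻¹ : ℂ) • b)) := by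
  refine ⟨_, _, ?_, ?_, rfl⟩
  · rw [norm_smul, norm_inv, Complex.norm_real, norm_norm, inv_mul_cancel₀ (norm_ne_zero_iff.2 ha)]
  · rw [norm_smul, norm_inv, Complex.norm_real, norm_norm, inv_mul_cancel₀ (norm_ne_zero_iff.2 hb)]

/-- No product state is orthogonal to all the members of `S`. -/
def IsUnextendible {m n : ℕ} (S : Set (Bipartite m n)) : Prop :=
  ∀ z ∈ complementarySubspace S, ¬ IsProductState z

theorem IsUnextendible.exists_inner_ne_zero {m n : ℕ} {ι : Type*} {α : ι → Qudit m}
    {β : ι → Qudit n} (h : IsUnextendible (Set.range fun i => α i ⊗ₜ[ℂ] β i)) {x : Qudit m}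
    {y : Qudit n} (hx : x ≠ 0) (hy : y ≠ 0) :
    ∃ j, inner ℂ x (α j) ≠ 0 ∧ inner ℂ y (β j) ≠ 0 := by
  by_contra! hcon
  refine h _ (mem_complementarySubspace.2 ?_) (isProductState_tmul_normalize hx hy)
  rintro _ ⟨j, rfl⟩
  rw [TensorProduct.inner_tmul, inner_smul_right, inner_smul_right]
  by_cases h1 : inner ℂ x (α j) = 0
  · rw [inner_eq_zero_symm.1 h1]
    simp
  · rw [inner_eq_zero_symm.1 (hcon j h1)]
    simp

/-- A proper subspace lies in the kernel of a nonzero functional, and functionals on the tensor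
product are bilinear forms. -/
theorem span_range_tmul_eq_top {m n : ℕ} {ι : Type*} {α : ι → Qudit m} {β : ι → Qudit n}
    (h : ∀ Φ : Qudit m →ₗ[ℂ] Qudit n →ₗ[ℂ] ℂ, (∀ j, Φ (α j) (β j) = 0) → Φ = 0) :
    Submodule.span ℂ (Set.range fun i => α i ⊗ₜ[ℂ] β i) = ⊤ := by
  by_contra hne
  obtain ⟨f, hf, hle⟩ := Submodule.exists_le_ker_of_lt_top _ (lt_top_iff_ne_top.2 hne)
  have := h ((TensorProduct.mk ℂ (Qudit m) (Qudit n)).compr₂ f) fun j =>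
    hle (Submodule.subset_span ⟨j, rfl⟩)
  apply hf
  ext a b
  simpa using congrArg (fun Φ => Φ a b) this

/-- `S` contains three states whose local states of one of the parties are mutually orthogonal. -/
def HasTriangle (S : Set (Bipartite 3 3)) : Prop :=
  ∃ a b : Fin 3 → Qudit 3, (∀ i, ‖a i‖ = 1) ∧ (∀ i, ‖b i‖ = 1) ∧ (∀ i, a i ⊗ₜ[ℂ] b i ∈ S) ∧
    (Orthonormal ℂ a ∨ Orthonormal ℂ b)

theorem HasTriangle.mono {S T : Set (Bipartite 3 3)} (h : HasTriangle S) (hST : S ⊆ T) :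
    HasTriangle T := by
  obtain ⟨a, b, ha, hb, hS, h⟩ := h
  exact ⟨a, b, ha, hb, fun i => hST (hS i), h⟩

theorem IsPB.exists_family {m n : ℕ} {S : Set (Bipartite m n)} (hS : IsPB S) :
    ∃ (α : S → Qudit m) (β : S → Qudit n), (∀ x, ‖α x‖ = 1) ∧ (∀ x, ‖β x‖ = 1) ∧
      (∀ x : S, (x : Bipartite m n) = α x ⊗ₜ[ℂ] β x) ∧
      ∀ x y, x ≠ y → inner ℂ (α x) (α y) = 0 ∨ inner ℂ (β x) (β y) = 0 := by
  choose α β hα hβ h using fun x : S => hS.1 x x.2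
  refine ⟨α, β, hα, hβ, h, fun x y hxy => ?_⟩
  have := hS.2 x x.2 y y.2 fun h => hxy (Subtype.ext h)
  rwa [h x, h y, TensorProduct.inner_tmul, mul_eq_zero] at this

theorem Orthonormal.of_eq_smul {ι E : Type*} [NormedAddCommGroup E] [InnerProductSpace ℂ E]
    {v w : ι → E} (hv : Orthonormal ℂ v) (hw : ∀ i, ‖w i‖ = 1) (h : ∀ i, ∃ c : ℂ, w i = c • v i) :
    Orthonormal ℂ w := by
  refine ⟨hw, fun i j hij => ?_⟩
  obtain ⟨c, hc⟩ := h i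
  obtain ⟨d, hd⟩ := h j
  change inner ℂ (w i) (w j) = 0
  rw [hc, hd, inner_smul_left, inner_smul_right, hv.2 hij]
  simp

theorem IsPB.span_eq_top_of_hasTriangle {S : Set (Bipartite 3 3)} (hS : IsPB S)
    (htri : HasTriangle S) (hU : IsUnextendible S) : Submodule.span ℂ S = ⊤ := by
  obtain ⟨α, β, hα, hβ, h, hpair⟩ := hS.exists_family
  have hrange : S = Set.range fun x : S => α x ⊗ₜ[ℂ] β x := by
    ext x
    refine ⟨fun hx => ⟨⟨x, hx⟩, (h ⟨x, hx⟩).symm⟩, ?_⟩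
    rintro ⟨x, rfl⟩
    change α x ⊗ₜ[ℂ] β x ∈ S
    rw [← h x]
    exact x.2
  obtain ⟨a, b, ha, hb, hab, hor⟩ := htri
  have hU' : IsUnextendible (Set.range fun x : S => α x ⊗ₜ[ℂ] β x) := hrange ▸ hU
  have hspan : Submodule.span ℂ (Set.range fun x : S => α x ⊗ₜ[ℂ] β x) = ⊤ := by
    apply span_range_tmul_eq_top
    intro Φ hΦ
    rcases hor with hor | hor
    · exact form_eq_zero_of_orthonormal_left (t := fun i => ⟨_, hab i⟩) hα hβ hpair
        (hor.of_eq_smul (fun i => hα _) fun i => ⟨_, tmul_left_eq_smul (hβ _) (h ⟨_, hab i⟩).symm⟩)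
        (fun x y hx hy => hU'.exists_inner_ne_zero hx hy) hΦ
    · have : Φ.flip = 0 := form_eq_zero_of_orthonormal_left (t := fun i => ⟨_, hab i⟩) hβ hα
        (fun j l hjl => (hpair j l hjl).symm)
        (hor.of_eq_smul (fun i => hβ _)
          fun i => ⟨_, tmul_right_eq_smul (hα _) (h ⟨_, hab i⟩).symm⟩)
        (fun x y hx hy => (hU'.exists_inner_ne_zero hy hx).imp fun _ h => h.symm)
        (fun j => hΦ j)
      rw [← Φ.flip_flip, this]
      rfl
  exact hrange ▸ hspan

theorem IsPB.insert {m n : ℕ} {S : Set (Bipartite m n)} (hS : IsPB S) {z : Bipartite m n}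
    (hz : IsProductState z) (hzS : z ∈ complementarySubspace S) : IsPB (insert z S) := by
  rw [mem_complementarySubspace] at hzS
  refine ⟨?_, ?_⟩
  · rintro x (rfl | hx)
    · exact hz
    · exact hS.1 x hx
  · rintro x (rfl | hx) y (rfl | hy) hxy
    · exact absurd rfl hxy
    · exact (inner_eq_zero_symm (E := Bipartite m n) (𝕜 := ℂ)).1 (hzS y hy)
    · exact hzS x hx
    · exact hS.2 x hx y hy hxy

/-- Zorn's lemma: a product state orthogonal to a maximal product basis could be adjoined, hence
would be a member orthogonal to itself. -/
theorem IsPB.exists_unextendible_superset {m n : ℕ} {S : Set (Bipartite m n)} (hS : IsPB S) :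
    ∃ T, S ⊆ T ∧ IsPB T ∧ IsUnextendible T := by
  obtain ⟨T, hST, hT⟩ := zorn_subset_nonempty {T : Set (Bipartite m n) | IsPB T}
    (fun c hc hchain _ => ⟨⋃₀ c, ⟨by
      rintro x ⟨s, hs, hx⟩
      exact (hc hs).1 x hx, by
      rintro x ⟨s, hs, hx⟩ y ⟨t, ht, hy⟩ hxy
      rcases hchain.total hs ht with h | h
      · exact (hc ht).2 x (h hx) y hy hxy
      · exact (hc hs).2 x hx y (h hy) hxy⟩, fun s hs => Set.subset_sUnion_of_mem hs⟩) S hS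
  refine ⟨T, hST, hT.prop, fun z hz hprod => ?_⟩
  have hzT : z ∈ T := hT.le_of_ge (hT.prop.insert hprod hz) (Set.subset_insert z T)
    (Set.mem_insert z T)
  exact hprod.ne_zero (inner_self_eq_zero.1 (mem_complementarySubspace.1 hz z hzT))

theorem IsPB.isCompletable_of_hasTriangle {S : Set (Bipartite 3 3)} (hS : IsPB S)
    (htri : HasTriangle S) : IsCompletable S := by
  obtain ⟨T, hST, hT, hU⟩ := hS.exists_unextendible_superset
  exact ⟨T, hST, hT, hT.span_eq_top_of_hasTriangle (htri.mono hST) hU⟩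

theorem IsPB.orthonormal {m n : ℕ} {S : Set (Bipartite m n)} (hS : IsPB S) :
    Orthonormal ℂ ((↑) : S → Bipartite m n) :=
  ⟨fun x => (hS.1 x x.2).norm_eq_one, fun x y hxy =>
    hS.2 x x.2 y y.2 fun h => hxy (Subtype.ext h)⟩

theorem IsPB.finite {m n : ℕ} {S : Set (Bipartite m n)} (hS : IsPB S) : S.Finite :=
  LinearIndependent.setFinite hS.orthonormal.linearIndependent

/-- If no product state lies in the complement, the only competing set T is empty, and the counting
condition says just that the complement is nonzero. -/
theorem isUPB_iff {m n : ℕ} {S : Set (Bipartite m n)} :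
    IsUPB S ↔ IsPB S ∧ IsUnextendible S ∧ Submodule.span ℂ S ≠ ⊤ := by
  constructor
  · rintro ⟨⟨hS, h⟩, hU⟩
    refine ⟨hS, hU, fun htop => ?_⟩
    have h0 := h ∅ ⟨by simp, by simp⟩ (by simp)
    rw [complementarySubspace, htop, Submodule.top_orthogonal_eq_bot, finrank_bot] at h0
    omega
  · rintro ⟨hS, hU, htop⟩
    refine ⟨⟨hS, fun T hT hTS => ?_⟩, hU⟩
    have hT0 : T = ∅ := Set.eq_empty_of_forall_notMem fun x hx => hU x (hTS x hx) (hT.1 x hx)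
    rw [hT0, Set.ncard_empty, Module.finrank_pos_iff, Submodule.nontrivial_iff_ne_bot]
    rwa [complementarySubspace, Ne, Submodule.orthogonal_eq_bot_iff]

theorem IsUPB.not_hasTriangle {S : Set (Bipartite 3 3)} (hS : IsUPB S) : ¬ HasTriangle S := by
  rw [isUPB_iff] at hS
  exact fun h => hS.2.2 (hS.1.span_eq_top_of_hasTriangle h hS.2.1)

theorem orthonormal_vec_three {n : ℕ} {u v w : Qudit n} (hu : ‖u‖ = 1) (hv : ‖v‖ = 1)
    (hw : ‖w‖ = 1) (huv : inner ℂ u v = 0) (huw : inner ℂ u w = 0) (hvw : inner ℂ v w = 0) :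
    Orthonormal ℂ ![u, v, w] := by
  refine ⟨?_, ?_⟩
  · intro i
    fin_cases i <;> simpa
  · intro i j hij
    fin_cases i <;> fin_cases j <;> first
      | exact absurd rfl hij
      | exact huv
      | exact huw
      | exact hvw
      | exact inner_eq_zero_symm.1 huv
      | exact inner_eq_zero_symm.1 huw
      | exact inner_eq_zero_symm.1 hvw

theorem hasTriangle_of_left {S : Set (Bipartite 3 3)} {ι : Type*} {α β : ι → Qudit 3}
    (hα : ∀ i, ‖α i‖ = 1) (hβ : ∀ i, ‖β i‖ = 1) (hS : ∀ i, α i ⊗ₜ[ℂ] β i ∈ S) {i j k : ι}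
    (hij : inner ℂ (α i) (α j) = 0) (hik : inner ℂ (α i) (α k) = 0)
    (hjk : inner ℂ (α j) (α k) = 0) : HasTriangle S :=
  ⟨![α i, α j, α k], ![β i, β j, β k], by simp [Fin.forall_fin_succ, hα],
    by simp [Fin.forall_fin_succ, hβ], by simp [Fin.forall_fin_succ, hS],
    Or.inl (orthonormal_vec_three (hα i) (hα j) (hα k) hij hik hjk)⟩

theorem hasTriangle_of_right {S : Set (Bipartite 3 3)} {ι : Type*} {α β : ι → Qudit 3}
    (hα : ∀ i, ‖α i‖ = 1) (hβ : ∀ i, ‖β i‖ = 1) (hS : ∀ i, α i ⊗ₜ[ℂ] β i ∈ S) {i j k : ι}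
    (hij : inner ℂ (β i) (β j) = 0) (hik : inner ℂ (β i) (β k) = 0)
    (hjk : inner ℂ (β j) (β k) = 0) : HasTriangle S :=
  ⟨![α i, α j, α k], ![β i, β j, β k], by simp [Fin.forall_fin_succ, hα],
    by simp [Fin.forall_fin_succ, hβ], by simp [Fin.forall_fin_succ, hS],
    Or.inr (orthonormal_vec_three (hβ i) (hβ j) (hβ k) hij hik hjk)⟩

/-! ### Counting members by colouring complete graphs -/

/-- Every two-colouring of the edges of `K₆` has a monochromatic triangle. -/
theorem exists_monochromatic_triangle {A B : Fin 6 → Fin 6 → Prop}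
    (hAB : ∀ i j, i ≠ j → A i j ∨ B i j) :
    ∃ i j k, (A i j ∧ A i k ∧ A j k) ∨ (B i j ∧ B i k ∧ B j k) := by
  classical
  by_contra! h
  -- Pigeonhole: of the five edges at vertex 0, three have the same colour.
  have key : ∀ f : Fin 5 → Bool, ∃ x y z, x < y ∧ y < z ∧ f x = f y ∧ f x = f z := by decide
  obtain ⟨x, y, z, hxy, hyz, h1, h2⟩ := key fun i => decide (A 0 i.succ)
  have hxy' : x.succ ≠ y.succ := fun h => hxy.ne (Fin.succ_injective _ h)
  have hyz' : y.succ ≠ z.succ := fun h => hyz.ne (Fin.succ_injective _ h)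
  have hxz' : x.succ ≠ z.succ := fun h => (hxy.trans hyz).ne (Fin.succ_injective _ h)
  have hB : ∀ i : Fin 5, ¬ A 0 i.succ → B 0 i.succ := fun i hi =>
    (hAB _ _ (Fin.succ_ne_zero i).symm).resolve_left hi
  rw [decide_eq_decide] at h1 h2
  by_cases hx : A 0 x.succ
  · have hy := h1.1 hx
    have hz := h2.1 hx
    exact (h x.succ y.succ z.succ).2 ((hAB _ _ hxy').resolve_left ((h 0 _ _).1 hx hy))
      ((hAB _ _ hxz').resolve_left ((h 0 _ _).1 hx hz))
      ((hAB _ _ hyz').resolve_left ((h 0 _ _).1 hy hz))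
  · have hy := fun h => hx (h1.2 h)
    have hz := fun h => hx (h2.2 h)
    exact (h x.succ y.succ z.succ).1
      ((hAB _ _ hxy').resolve_right ((h 0 _ _).2 (hB x hx) (hB y hy)))
      ((hAB _ _ hxz').resolve_right ((h 0 _ _).2 (hB x hx) (hB z hz)))
      ((hAB _ _ hyz').resolve_right ((h 0 _ _).2 (hB y hy) (hB z hz)))

theorem IsPB.hasTriangle_of_six_le {S : Set (Bipartite 3 3)} (hS : IsPB S) (h6 : 6 ≤ S.ncard) :
    HasTriangle S := by
  obtain ⟨α, β, hα, hβ, h, hpair⟩ := hS.exists_family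
  have := hS.finite.fintype
  obtain ⟨f⟩ : Nonempty (Fin 6 ↪ S) := Function.Embedding.nonempty_of_card_le (by
    rwa [Fintype.card_fin, ← Nat.card_eq_fintype_card, Nat.card_coe_set_eq])
  obtain ⟨i, j, k, ⟨h1, h2, h3⟩ | ⟨h1, h2, h3⟩⟩ := exists_monochromatic_triangle
    (A := fun i j => inner ℂ (α (f i)) (α (f j)) = 0)
    (B := fun i j => inner ℂ (β (f i)) (β (f j)) = 0)
    fun i j hij => hpair _ _ fun h => hij (f.injective h)
  · exact hasTriangle_of_left hα hβ (fun x => h x ▸ x.2) h1 h2 h3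
  · exact hasTriangle_of_right hα hβ (fun x => h x ▸ x.2) h1 h2 h3

/-- With at most four members, choose x orthogonal to two of Alice's states and y orthogonal to
Bob's states of the other two; x ⊗ y then extends the set. -/
theorem IsUnextendible.five_le_ncard {S : Set (Bipartite 3 3)} (hS : IsPB S)
    (hU : IsUnextendible S) : 5 ≤ S.ncard := by
  by_contra! hlt
  obtain ⟨α, β, hα, hβ, h, hpair⟩ := hS.exists_family
  have := hS.finite.fintype
  obtain ⟨f⟩ : Nonempty (S ↪ Fin 4) := Function.Embedding.nonempty_of_card_le (by
    rw [Fintype.card_fin, ← Nat.card_eq_fintype_card, Nat.card_coe_set_eq]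
    omega)
  -- Members are placed in four slots; an unused slot carries the zero vector and imposes no
  -- condition.
  have hext : ∀ γ : S → Qudit 3, ∀ x, Function.extend f γ 0 (f x) = γ x := fun γ x =>
    f.injective.extend_apply γ 0 x
  obtain ⟨x, hx, hx0, hx1⟩ := exists_unit_orthogonal_pair (Function.extend f α 0 0)
    (Function.extend f α 0 1)
  obtain ⟨y, hy, hy2, hy3⟩ := exists_unit_orthogonal_pair (Function.extend f β 0 2)
    (Function.extend f β 0 3)
  refine hU (x ⊗ₜ y) (mem_complementarySubspace.2 fun s hs => ?_) ⟨x, y, hx, hy, rfl⟩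
  have hs' := h ⟨s, hs⟩
  change s = _ at hs'
  have hcase : ∀ i : Fin 4, i = 0 ∨ i = 1 ∨ i = 2 ∨ i = 3 := by decide
  rw [hs', TensorProduct.inner_tmul, mul_eq_zero]
  rcases hcase (f ⟨s, hs⟩) with hf | hf | hf | hf
  · rw [← hf, hext] at hx0
    exact Or.inl (inner_eq_zero_symm.1 hx0)
  · rw [← hf, hext] at hx1
    exact Or.inl (inner_eq_zero_symm.1 hx1)
  · rw [← hf, hext] at hy2
    exact Or.inr (inner_eq_zero_symm.1 hy2)
  · rw [← hf, hext] at hy3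
    exact Or.inr (inner_eq_zero_symm.1 hy3)

theorem IsUPB.ncard_eq_five {S : Set (Bipartite 3 3)} (hS : IsUPB S) : S.ncard = 5 := by
  have h := isUPB_iff.1 hS
  refine le_antisymm ?_ (h.2.1.five_le_ncard h.1)
  by_contra! hlt
  exact hS.not_hasTriangle (h.1.hasTriangle_of_six_le hlt)

/-! ### The triangle-free colouring of K₅ and the pentagon graph -/

/-- The symmetric `5 × 5` matrix with zero diagonal and the given entries. -/
def boolGraph (a b c d e f g h i j : Bool) : Fin 5 → Fin 5 → Bool :=
  ![![false, a, b, c, d], ![a, false, e, f, g], ![b, e, false, h, i], ![c, f, h, false, j],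
    ![d, g, i, j, false]]

-- A finite check over all 2¹⁰ graphs on five vertices: without a triangle in the graph or its
-- complement there is a Hamiltonian cycle, normalized to start at 0.
set_option synthInstance.maxHeartbeats 400000 in
set_option synthInstance.maxSize 4096 in
theorem exists_cycle_of_boolGraph : ∀ a b c d e f g h i j : Bool,
    (∀ x y z, x < y → y < z → ¬ (boolGraph a b c d e f g h i j x y =
        boolGraph a b c d e f g h i j x z ∧ boolGraph a b c d e f g h i j x z =
        boolGraph a b c d e f g h i j y z)) →
      ∃ p q r s : Fin 5, (0 ≠ p ∧ 0 ≠ q ∧ 0 ≠ r ∧ 0 ≠ s ∧ p ≠ q ∧ p ≠ r ∧ p ≠ s ∧ q ≠ r ∧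
        q ≠ s ∧ r ≠ s) ∧ boolGraph a b c d e f g h i j 0 p = true ∧
        boolGraph a b c d e f g h i j p q = true ∧ boolGraph a b c d e f g h i j q r = true ∧
        boolGraph a b c d e f g h i j r s = true ∧ boolGraph a b c d e f g h i j s 0 = true := by
  decide +kernel

theorem injective_vec_five {X : Type*} {o p q r s : X} (h1 : o ≠ p) (h2 : o ≠ q) (h3 : o ≠ r)
    (h4 : o ≠ s) (h5 : p ≠ q) (h6 : p ≠ r) (h7 : p ≠ s) (h8 : q ≠ r) (h9 : q ≠ s) (h10 : r ≠ s) :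
    Function.Injective ![o, p, q, r, s] := by
  intro i j hij
  by_contra hne
  fin_cases i <;> fin_cases j <;> first
    | exact hne rfl
    | exact h1 hij | exact h2 hij | exact h3 hij | exact h4 hij | exact h5 hij
    | exact h6 hij | exact h7 hij | exact h8 hij | exact h9 hij | exact h10 hij
    | exact h1 hij.symm | exact h2 hij.symm | exact h3 hij.symm | exact h4 hij.symm
    | exact h5 hij.symm | exact h6 hij.symm | exact h7 hij.symm | exact h8 hij.symm
    | exact h9 hij.symm | exact h10 hij.symm

/-- The only two-colouring of the edges of `K₅` without monochromatic triangles is the pentagon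
with its pentagram. -/
theorem exists_pentagon {A B : Fin 5 → Fin 5 → Prop} (hA : ∀ i j, A i j → A j i)
    (hB : ∀ i j, B i j → B j i) (hA' : ∀ i, ¬ A i i) (hB' : ∀ i, ¬ B i i)
    (hAB : ∀ i j, i ≠ j → A i j ∨ B i j) (hAt : ∀ i j k, A i j → A i k → ¬ A j k)
    (hBt : ∀ i j k, B i j → B i k → ¬ B j k) :
    ∃ σ : Fin 5 → Fin 5, Function.Injective σ ∧
      (∀ i j, A (σ i) (σ j) ↔ j = i + 1 ∨ i = j + 1) ∧
      (∀ i j, B (σ i) (σ j) ↔ j = i + 2 ∨ i = j + 2) := by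
  classical
  obtain ⟨σ, hσ, hcyc⟩ : ∃ σ : Fin 5 → Fin 5, Function.Injective σ ∧
      ∀ i, A (σ i) (σ (i + 1)) := by
    have hM : ∀ i j, boolGraph (decide (A 0 1)) (decide (A 0 2)) (decide (A 0 3)) (decide (A 0 4))
        (decide (A 1 2)) (decide (A 1 3)) (decide (A 1 4)) (decide (A 2 3)) (decide (A 2 4))
        (decide (A 3 4)) i j = decide (A i j) := by
      have hc : ∀ i j, A i j ↔ A j i := fun i j => ⟨hA i j, hA j i⟩
      intro i j
      fin_cases i <;> fin_cases j <;> simp [boolGraph, hA'] <;> apply hc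
    have := exists_cycle_of_boolGraph (decide (A 0 1)) (decide (A 0 2)) (decide (A 0 3))
      (decide (A 0 4)) (decide (A 1 2)) (decide (A 1 3)) (decide (A 1 4)) (decide (A 2 3))
      (decide (A 2 4)) (decide (A 3 4))
    simp only [hM, decide_eq_decide, decide_eq_true_eq] at this
    obtain ⟨p, q, r, s, ⟨h1, h2, h3, h4, h5, h6, h7, h8, h9, h10⟩, hp, hq, hr, hs, h0⟩ := this (by
      rintro x y z hxy hyz ⟨h1, h2⟩
      by_cases hx : A x y
      · exact hAt x y z hx (h1.1 hx) (h2.1 (h1.1 hx))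
      · have hxz := fun h => hx (h1.2 h)
        have hyz' := fun h => hxz (h2.2 h)
        exact hBt x y z ((hAB _ _ hxy.ne).resolve_left hx)
          ((hAB _ _ (hxy.trans hyz).ne).resolve_left hxz) ((hAB _ _ hyz.ne).resolve_left hyz'))
    refine ⟨![0, p, q, r, s], ?_, ?_⟩
    · exact injective_vec_five h1 h2 h3 h4 h5 h6 h7 h8 h9 h10
    · intro i
      fin_cases i
      exacts [hp, hq, hr, hs, h0]
  have hne : ∀ i k, k ≠ 0 → σ i ≠ σ (i + k) := fun i k hk h => hk (by simpa using hσ h)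
  -- A chord joining vertices two apart would close a triangle with two edges of the A-cycle, so
  -- these pairs have colour B only.
  have hAn : ∀ i, ¬ A (σ i) (σ (i + 2)) := fun i h =>
    hAt _ _ _ (hA _ _ (hcyc i)) (by simpa [add_assoc] using hcyc (i + 1)) h
  have hB2 : ∀ i, B (σ i) (σ (i + 2)) := fun i =>
    (hAB _ _ (hne i 2 (by decide))).resolve_left (hAn i)
  -- Vertex i + 3 is joined by pentagram edges to both i and i + 1, so a B-edge between these would
  -- close a triangle.
  have hBn : ∀ i, ¬ B (σ i) (σ (i + 1)) := fun i h => by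
    have h1 := hB2 (i + 3)
    have h2 := hB2 (i + 1)
    have e1 : i + 3 + 2 = i := by rw [add_assoc]; exact add_zero i
    have e2 : i + 1 + 2 = i + 3 := by rw [add_assoc]; rfl
    rw [e1] at h1
    rw [e2] at h2
    exact hBt _ _ _ h1 (hB _ _ h2) h
  have hcases : ∀ i j : Fin 5, j = i ∨ j = i + 1 ∨ i = j + 1 ∨ j = i + 2 ∨ i = j + 2 := by decide
  have d1 : ∀ i : Fin 5, ¬ (i = i + 1 ∨ i = i + 1) := by decide
  have d2 : ∀ i : Fin 5, ¬ (i = i + 2 ∨ i = i + 2) := by decide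
  have d3 : ∀ i : Fin 5, ¬ (i + 2 = i + 1 ∨ i = i + 2 + 1) := by decide
  have d4 : ∀ i : Fin 5, ¬ (i + 1 = i + 2 ∨ i = i + 1 + 2) := by decide
  refine ⟨σ, hσ, fun i j => ?_, fun i j => ?_⟩
  · rcases hcases i j with rfl | rfl | rfl | rfl | rfl
    · exact iff_of_false (hA' _) (d1 _)
    · exact iff_of_true (hcyc _) (Or.inl rfl)
    · exact iff_of_true (hA _ _ (hcyc _)) (Or.inr rfl)
    · exact iff_of_false (hAn _) (d3 _)
    · exact iff_of_false (fun h => hAn _ (hA _ _ h)) fun h => d3 _ h.symm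
  · rcases hcases i j with rfl | rfl | rfl | rfl | rfl
    · exact iff_of_false (hB' _) (d2 _)
    · exact iff_of_false (hBn _) (d4 _)
    · exact iff_of_false (fun h => hBn _ (hB _ _ h)) fun h => d4 _ h.symm
    · exact iff_of_true (hB2 _) (Or.inl rfl)
    · exact iff_of_true (hB _ _ (hB2 _)) (Or.inr rfl)

/-- Five unit vectors of which exactly the cyclic neighbours are orthogonal. -/
structure IsPentagon {d : ℕ} (v : Fin 5 → Qudit d) : Prop where
  norm_eq : ∀ i, ‖v i‖ = 1
  inner_eq_zero_iff : ∀ i j, inner ℂ (v i) (v j) = 0 ↔ j = i + 1 ∨ i = j + 1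

/-- Doubling modulo 5 carries the cycle to the pentagram, so Bob's vectors taken in the order 2 * i
form a pentagon too; 3 is the inverse of 2. Injectivity is automatic, since members with different
indices are orthogonal and nonzero. -/
theorem hasPentagonGraph_iff {S : Set (Bipartite 3 3)} :
    HasPentagonGraph S ↔ ∃ a b : Fin 5 → Qudit 3, IsPentagon a ∧ IsPentagon (fun i => b (2 * i)) ∧
      S = Set.range fun i => a i ⊗ₜ[ℂ] b i := by
  have hA : ∀ i j : Fin 5, (SimpleGraph.cycleGraph 5).Adj i j ↔ j = i + 1 ∨ i = j + 1 := by
    simp only [SimpleGraph.cycleGraph_adj]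
    decide
  have hB : ∀ i j : Fin 5, (¬ (2 * i = 2 * j) ∧ ¬ (2 * j = 2 * i + 1 ∨ 2 * i = 2 * j + 1)) ↔
      (j = i + 1 ∨ i = j + 1) := by decide
  have hdouble : ∀ i : Fin 5, 2 * (3 * i) = i := by decide
  constructor
  · rintro ⟨a, b, ha, hb, -, rfl, hGA, hGB⟩
    refine ⟨a, b, ⟨ha, fun i j => ?_⟩, ⟨fun i => hb _, fun i j => ?_⟩, rfl⟩
    · rw [← hA, ← hGA]
      rfl
    · rw [← hB, ← hA, ← Ne, ← SimpleGraph.compl_adj, ← hGB]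
      rfl
  · rintro ⟨a, b, ha, hb, rfl⟩
    have hb' : ∀ i, ‖b i‖ = 1 := fun i => by simpa [hdouble] using hb.norm_eq (3 * i)
    have hGA : localOrthogonalityGraph a ha.norm_eq = SimpleGraph.cycleGraph 5 := by
      ext i j
      exact (ha.inner_eq_zero_iff i j).trans (hA i j).symm
    have hGB : localOrthogonalityGraph b hb' = (SimpleGraph.cycleGraph 5)ᶜ := by
      ext i j
      have := (hb.inner_eq_zero_iff (3 * i) (3 * j)).trans (hB _ _).symm
      rw [hdouble, hdouble, ← hA, ← Ne, ← SimpleGraph.compl_adj] at this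
      exact this
    refine ⟨a, b, ha.norm_eq, hb', fun i j hij => ?_, rfl, hGA, hGB⟩
    by_contra hne
    have hor : inner ℂ (a i) (a j) = 0 ∨ inner ℂ (b i) (b j) = 0 := by
      by_cases h : (SimpleGraph.cycleGraph 5).Adj i j
      · rw [← hGA] at h
        exact Or.inl h
      · have h' : (SimpleGraph.cycleGraph 5)ᶜ.Adj i j := ⟨hne, h⟩
        rw [← hGB] at h'
        exact Or.inr h'
    have h0 : inner ℂ (a i ⊗ₜ[ℂ] b i) (a j ⊗ₜ[ℂ] b j) = 0 := by
      rw [TensorProduct.inner_tmul, mul_eq_zero]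
      exact hor
    change a i ⊗ₜ[ℂ] b i = a j ⊗ₜ[ℂ] b j at hij
    rw [hij, TensorProduct.inner_tmul, mul_eq_zero, inner_self_eq_zero, inner_self_eq_zero] at h0
    rcases h0 with h0 | h0
    · simpa [h0] using ha.norm_eq j
    · simpa [h0] using hb' j

theorem IsUPB.hasPentagonGraph {S : Set (Bipartite 3 3)} (hS : IsUPB S) : HasPentagonGraph S := by
  have hPB := (isUPB_iff.1 hS).1
  obtain ⟨α, β, hα, hβ, h, hpair⟩ := hPB.exists_family
  have := hPB.finite.fintype
  have hcard : Fintype.card S = 5 := by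
    rw [← Nat.card_eq_fintype_card, Nat.card_coe_set_eq, hS.ncard_eq_five]
  let f : Fin 5 ≃ S := (Fintype.equivFinOfCardEq hcard).symm
  have hmem : ∀ x, α x ⊗ₜ[ℂ] β x ∈ S := fun x => h x ▸ x.2
  have hself : ∀ {v : Qudit 3}, ‖v‖ = 1 → ¬ inner ℂ v v = 0 := by
    intro v hv h0
    rw [inner_self_eq_zero] at h0
    simp [h0] at hv
  obtain ⟨σ, hσ, hA, hB⟩ := exists_pentagon
    (A := fun i j => inner ℂ (α (f i)) (α (f j)) = 0)
    (B := fun i j => inner ℂ (β (f i)) (β (f j)) = 0)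
    (fun _ _ h => inner_eq_zero_symm.1 h) (fun _ _ h => inner_eq_zero_symm.1 h)
    (fun i => hself (hα _)) (fun i => hself (hβ _))
    (fun i j hij => hpair _ _ fun h => hij (f.injective h))
    (fun i j k h1 h2 h3 => hS.not_hasTriangle (hasTriangle_of_left hα hβ hmem h1 h2 h3))
    (fun i j k h1 h2 h3 => hS.not_hasTriangle (hasTriangle_of_right hα hβ hmem h1 h2 h3))
  have hdbl : ∀ i j : Fin 5, (2 * j = 2 * i + 2 ∨ 2 * i = 2 * j + 2) ↔ (j = i + 1 ∨ i = j + 1) := by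
    decide
  refine hasPentagonGraph_iff.2 ⟨fun i => α (f (σ i)), fun i => β (f (σ i)),
    ⟨fun i => hα _, hA⟩, ⟨fun i => hβ _, fun i j => (hB _ _).trans (hdbl i j)⟩, ?_⟩
  ext x
  refine ⟨fun hx => ?_, ?_⟩
  · obtain ⟨i, hi⟩ := (Finite.injective_iff_surjective.1 hσ) (f.symm ⟨x, hx⟩)
    refine ⟨i, ?_⟩
    change α (f (σ i)) ⊗ₜ[ℂ] β (f (σ i)) = x
    rw [← h, hi, Equiv.apply_symm_apply]
  · rintro ⟨i, rfl⟩
    exact hmem _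

/-! ### Independence in pentagons, and why they give UPBs -/

namespace IsPentagon

variable {d : ℕ} {v : Fin 5 → Qudit d}

theorem rotate (hv : IsPentagon v) (k : Fin 5) : IsPentagon fun i => v (i + k) where
  norm_eq i := hv.norm_eq _
  inner_eq_zero_iff i j := by
    rw [hv.inner_eq_zero_iff, add_right_comm, add_right_comm j, add_left_inj, add_left_inj]

theorem inner_self_ne (hv : IsPentagon v) (i : Fin 5) : inner ℂ (v i) (v i) ≠ 0 := by
  rw [Ne, hv.inner_eq_zero_iff]
  revert i
  decide

/-- Pair a relation with v 1, which is orthogonal to its two neighbours, then with v 4, which is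
orthogonal to v 0 but not to v 2. -/
theorem linearIndependent_consecutive (hv : IsPentagon v) :
    LinearIndependent ℂ ![v 0, v 1, v 2] := by
  have h := fun i j => (hv.inner_eq_zero_iff i j)
  rw [Fintype.linearIndependent_iff]
  intro g hg
  simp only [Fin.sum_univ_three, Matrix.cons_val_zero, Matrix.cons_val_one, Matrix.cons_val] at hg
  have h1 : g 1 = 0 := by
    have := congrArg (inner ℂ (v 1)) hg
    simp only [inner_add_right, inner_smul_right, inner_zero_right, (h 1 0).2 (by decide),
      (h 1 2).2 (by decide), mul_zero, add_zero, zero_add, mul_eq_zero] at this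
    exact this.resolve_right (hv.inner_self_ne 1)
  have h2 : g 2 = 0 := by
    have := congrArg (inner ℂ (v 4)) hg
    simp only [h1, inner_add_right, inner_smul_right, inner_zero_right, (h 4 0).2 (by decide),
      zero_mul, mul_zero, add_zero, zero_add, mul_eq_zero] at this
    exact this.resolve_right fun h' => by simpa using (h 4 2).1 h'
  have h0 : g 0 = 0 := by
    have := congrArg (inner ℂ (v 0)) hg
    simp only [h1, h2, inner_add_right, inner_smul_right, inner_zero_right,
      zero_mul, add_zero, mul_eq_zero] at this
    exact this.resolve_right (hv.inner_self_ne 0)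
  intro i
  fin_cases i
  exacts [h0, h1, h2]

/-- Here v 4 is orthogonal to v 0 and v 3 but not to v 1; afterwards v 2 is orthogonal to v 3 but
not to v 0. -/
theorem linearIndependent_nonconsecutive (hv : IsPentagon v) :
    LinearIndependent ℂ ![v 0, v 1, v 3] := by
  have h := fun i j => (hv.inner_eq_zero_iff i j)
  rw [Fintype.linearIndependent_iff]
  intro g hg
  simp only [Fin.sum_univ_three, Matrix.cons_val_zero, Matrix.cons_val_one, Matrix.cons_val] at hg
  have h1 : g 1 = 0 := by
    have := congrArg (inner ℂ (v 4)) hg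
    simp only [inner_add_right, inner_smul_right, inner_zero_right, (h 4 0).2 (by decide),
      (h 4 3).2 (by decide), mul_zero, add_zero, zero_add, mul_eq_zero] at this
    exact this.resolve_right fun h' => by simpa using (h 4 1).1 h'
  have h0 : g 0 = 0 := by
    have := congrArg (inner ℂ (v 2)) hg
    simp only [h1, inner_add_right, inner_smul_right, inner_zero_right, (h 2 3).2 (by decide),
      zero_mul, mul_zero, add_zero, mul_eq_zero] at this
    exact this.resolve_right fun h' => by simpa using (h 2 0).1 h'
  have h3 : g 2 = 0 := by
    have := congrArg (inner ℂ (v 3)) hg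
    simp only [h1, h0, inner_add_right, inner_smul_right, inner_zero_right,
      zero_mul, zero_add, mul_eq_zero] at this
    exact this.resolve_right (hv.inner_self_ne 3)
  intro i
  fin_cases i
  exacts [h0, h1, h3]

end IsPentagon

theorem eq_zero_of_inner_eq_zero_of_linearIndependent {w : Fin 3 → Qudit 3}
    (hw : LinearIndependent ℂ w) {x : Qudit 3} (hx : ∀ i, inner ℂ (w i) x = 0) : x = 0 := by
  have htop := hw.span_eq_top_of_card_eq_finrank (by simp)
  have : x ∈ (Submodule.span ℂ (Set.range w))ᗮ := by
    rw [Submodule.mem_orthogonal]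
    intro u hu
    induction hu using Submodule.span_induction with
    | mem u hu =>
      obtain ⟨i, rfl⟩ := hu
      exact hx i
    | zero => simp
    | add p q _ _ hp hq => rw [inner_add_left, hp, hq, add_zero]
    | smul c p _ hp => rw [inner_smul_left, hp, mul_zero]
  rwa [htop, Submodule.top_orthogonal_eq_bot, Submodule.mem_bot] at this

namespace IsPentagon

variable {v : Fin 5 → Qudit 3}

/-- Any three vectors of a pentagon in a qutrit span the whole space. -/
theorem eq_zero_of_inner_eq_zero (hv : IsPentagon v) {x : Qudit 3} {k : Fin 5}
    (h : (inner ℂ (v k) x = 0 ∧ inner ℂ (v (1 + k)) x = 0 ∧ inner ℂ (v (2 + k)) x = 0) ∨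
      (inner ℂ (v k) x = 0 ∧ inner ℂ (v (1 + k)) x = 0 ∧ inner ℂ (v (3 + k)) x = 0)) :
    x = 0 := by
  rcases h with ⟨h0, h1, h2⟩ | ⟨h0, h1, h2⟩
  · refine eq_zero_of_inner_eq_zero_of_linearIndependent
      (hv.rotate k).linearIndependent_consecutive fun i => ?_
    fin_cases i
    exacts [by simpa using h0, h1, h2]
  · refine eq_zero_of_inner_eq_zero_of_linearIndependent
      (hv.rotate k).linearIndependent_nonconsecutive fun i => ?_
    fin_cases i
    exacts [by simpa using h0, h1, h2]

end IsPentagon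

theorem IsPentagon.of_inner {d : ℕ} {v : Fin 5 → Qudit d} (hn : ∀ i, ‖v i‖ = 1)
    (h1 : ∀ i, inner ℂ (v i) (v (i + 1)) = 0) (h2 : ∀ i, inner ℂ (v i) (v (i + 2)) ≠ 0) :
    IsPentagon v := by
  refine ⟨hn, fun i j => ?_⟩
  have hcases : ∀ i j : Fin 5, j = i ∨ j = i + 1 ∨ i = j + 1 ∨ j = i + 2 ∨ i = j + 2 := by decide
  have d1 : ∀ i : Fin 5, ¬ (i = i + 1 ∨ i = i + 1) := by decide
  have d2 : ∀ i : Fin 5, ¬ (i + 2 = i + 1 ∨ i = i + 2 + 1) := by decide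
  rcases hcases i j with rfl | rfl | rfl | rfl | rfl
  · refine iff_of_false (fun h => ?_) (d1 _)
    rw [inner_self_eq_zero] at h
    simpa [h] using hn j
  · exact iff_of_true (h1 _) (Or.inl rfl)
  · exact iff_of_true (inner_eq_zero_symm.1 (h1 _)) (Or.inr rfl)
  · exact iff_of_false (h2 _) (d2 _)
  · exact iff_of_false (fun h => h2 _ (inner_eq_zero_symm.1 h)) fun h => d2 _ h.symm

/-- Pairwise orthogonality of the members of a pentagon. -/
theorem IsPentagon.isPB {a b : Fin 5 → Qudit 3} (ha : IsPentagon a)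
    (hb : IsPentagon fun i => b (2 * i)) : IsPB (Set.range fun i => a i ⊗ₜ[ℂ] b i) := by
  have hdouble : ∀ i : Fin 5, 2 * (3 * i) = i := by decide
  have hcases : ∀ i j : Fin 5, i ≠ j →
      (j = i + 1 ∨ i = j + 1) ∨ (3 * j = 3 * i + 1 ∨ 3 * i = 3 * j + 1) := by decide
  constructor
  · rintro _ ⟨i, rfl⟩
    exact ⟨_, _, ha.norm_eq i, by simpa [hdouble] using hb.norm_eq (3 * i), rfl⟩
  · rintro _ ⟨i, rfl⟩ _ ⟨j, rfl⟩ hij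
    change inner ℂ (a i ⊗ₜ[ℂ] b i) (a j ⊗ₜ[ℂ] b j) = 0
    rw [TensorProduct.inner_tmul, mul_eq_zero]
    refine (hcases i j fun h => hij (by rw [h])).imp (ha.inner_eq_zero_iff i j).2 fun h => ?_
    simpa [hdouble] using (hb.inner_eq_zero_iff (3 * i) (3 * j)).2 h

theorem IsPentagon.isUnextendible {a b : Fin 5 → Qudit 3} (ha : IsPentagon a)
    (hb : IsPentagon fun i => b (2 * i)) :
    IsUnextendible (Set.range fun i => a i ⊗ₜ[ℂ] b i) := by
  classical
  rintro _ hz ⟨x, y, hx, hy, rfl⟩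
  have h : ∀ i, inner ℂ (a i) x = 0 ∨ inner ℂ (b i) y = 0 := fun i => by
    have := mem_complementarySubspace.1 hz _ ⟨i, rfl⟩
    change inner ℂ (a i ⊗ₜ[ℂ] b i) (x ⊗ₜ[ℂ] y) = 0 at this
    rwa [TensorProduct.inner_tmul, mul_eq_zero] at this
  -- Either f or its negation holds at three indices. Every three-element subset of ℤ/5 is a
  -- translate of {0, 1, 2} or {0, 1, 3}, and doubling permutes ℤ/5.
  have key : ∀ f : Fin 5 → Bool,
      (∃ k, (f k = true ∧ f (1 + k) = true ∧ f (2 + k) = true) ∨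
        (f k = true ∧ f (1 + k) = true ∧ f (3 + k) = true)) ∨
      (∃ k, (f (2 * k) ≠ true ∧ f (2 * (1 + k)) ≠ true ∧ f (2 * (2 + k)) ≠ true) ∨
        (f (2 * k) ≠ true ∧ f (2 * (1 + k)) ≠ true ∧ f (2 * (3 + k)) ≠ true)) := by decide
  have hx0 : x ≠ 0 := by
    rintro rfl
    simp at hx
  have hy0 : y ≠ 0 := by
    rintro rfl
    simp at hy
  have hk := key fun i => decide (inner ℂ (a i) x = 0)
  simp only [ne_eq, decide_eq_true_eq] at hk
  rcases hk with ⟨k, hk⟩ | ⟨k, hk⟩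
  · exact hx0 (ha.eq_zero_of_inner_eq_zero hk)
  · have h' : ∀ i, ¬ inner ℂ (a i) x = 0 → inner ℂ (b i) y = 0 := fun i hi =>
      (h i).resolve_left hi
    exact hy0 (hb.eq_zero_of_inner_eq_zero
      (hk.imp (And.imp (h' _) (And.imp (h' _) (h' _))) (And.imp (h' _) (And.imp (h' _) (h' _)))))

theorem IsPentagon.isUPB {a b : Fin 5 → Qudit 3} (ha : IsPentagon a)
    (hb : IsPentagon fun i => b (2 * i)) : IsUPB (Set.range fun i => a i ⊗ₜ[ℂ] b i) := by
  refine isUPB_iff.2 ⟨ha.isPB hb, ha.isUnextendible hb, fun htop => ?_⟩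
  -- Five vectors cannot span a space of dimension nine.
  have h1 := finrank_range_le_card (R := ℂ) fun i => a i ⊗ₜ[ℂ] b i
  rw [Set.finrank, htop, finrank_top, Module.finrank_tensorProduct, finrank_euclideanSpace_fin,
    Fintype.card_fin] at h1
  omega

theorem isUPB_iff_hasPentagonGraph {S : Set (Bipartite 3 3)} : IsUPB S ↔ HasPentagonGraph S := by
  refine ⟨IsUPB.hasPentagonGraph, fun h => ?_⟩
  obtain ⟨a, b, ha, hb, rfl⟩ := hasPentagonGraph_iff.1 h
  exact ha.isUPB hb

/-! ### The six-parameter family -/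

theorem inner_vec_three (a b c a' b' c' : ℂ) :
    inner ℂ (!₂[a, b, c] : Qudit 3) !₂[a', b', c'] =
      starRingEnd ℂ a * a' + starRingEnd ℂ b * b' + starRingEnd ℂ c * c' := by
  rw [PiLp.inner_apply, Fin.sum_univ_three]
  simp [mul_comm]

theorem norm_eq_one_of_inner_self {E : Type*} [NormedAddCommGroup E] [InnerProductSpace ℂ E]
    {x : E} (h : inner ℂ x x = 1) : ‖x‖ = 1 := by
  rw [inner_self_eq_norm_sq_to_K] at h
  have h' : ‖x‖ ^ 2 = 1 := Complex.ofReal_injective (by simpa using h)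
  exact (pow_eq_one_iff_of_nonneg (norm_nonneg x) two_ne_zero).1 h'

theorem conj_exp_I_mul_mul_self (φ : ℝ) :
    starRingEnd ℂ (Complex.exp (Complex.I * φ)) * Complex.exp (Complex.I * φ) = 1 := by
  rw [← Complex.exp_conj, ← Complex.exp_add]
  simp

theorem forall_fin_five {P : Fin 5 → Prop} : (∀ i, P i) ↔ P 0 ∧ P 1 ∧ P 2 ∧ P 3 ∧ P 4 := by
  simp [Fin.forall_fin_succ]

namespace Angles

variable (p : Angles)

theorem aliceVector_zero : aliceVector p 0 = !₂[1, 0, 0] := rfl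

theorem aliceVector_one : aliceVector p 1 = !₂[0, 1, 0] := rfl

theorem aliceVector_two :
    aliceVector p 2 = !₂[(Real.cos p.θ : ℂ), 0, (Real.sin p.θ : ℂ)] := rfl

theorem aliceVector_three : aliceVector p 3 = !₂[(Real.sin p.γ : ℂ) * Real.sin p.θ,
    (Real.cos p.γ : ℂ) * Complex.exp (Complex.I * p.φ),
    -((Real.sin p.γ : ℂ) * Real.cos p.θ)] := rfl

theorem aliceVector_four : aliceVector p 4 = (1 / (p.N : ℂ)) • !₂[0,
    (Real.sin p.γ : ℂ) * Real.cos p.θ * Complex.exp (Complex.I * p.φ), (Real.cos p.γ : ℂ)] := rfl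

theorem inner_aliceVector_add_one :
    ∀ i, inner ℂ (aliceVector p i) (aliceVector p (i + 1)) = 0 := by
  have hE := conj_exp_I_mul_mul_self p.φ
  rw [forall_fin_five]
  refine ⟨?_, ?_, ?_, ?_, ?_⟩
  · rw [show (0 : Fin 5) + 1 = 1 from rfl, aliceVector_zero, aliceVector_one, inner_vec_three]
    simp
  · rw [show (1 : Fin 5) + 1 = 2 from rfl, aliceVector_one, aliceVector_two, inner_vec_three]
    simp
  · rw [show (2 : Fin 5) + 1 = 3 from rfl, aliceVector_two, aliceVector_three, inner_vec_three]
    simp only [Complex.conj_ofReal, map_zero]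
    ring
  · rw [show (3 : Fin 5) + 1 = 4 from rfl, aliceVector_three, aliceVector_four, inner_smul_right,
      inner_vec_three]
    simp only [Complex.conj_ofReal, map_neg, map_mul]
    linear_combination (Real.cos p.γ : ℂ) * (1 / (p.N : ℂ)) * Real.sin p.γ * Real.cos p.θ * hE
  · rw [show (4 : Fin 5) + 1 = 0 from rfl, aliceVector_four, aliceVector_zero, inner_smul_left,
      inner_vec_three]
    simp

theorem inner_aliceVector_zero_two :
    inner ℂ (aliceVector p 0) (aliceVector p 2) = (Real.cos p.θ : ℂ) := by
  rw [aliceVector_zero, aliceVector_two, inner_vec_three]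
  simp

theorem inner_aliceVector_one_three : inner ℂ (aliceVector p 1) (aliceVector p 3) =
    (Real.cos p.γ : ℂ) * Complex.exp (Complex.I * p.φ) := by
  rw [aliceVector_one, aliceVector_three, inner_vec_three]
  simp

theorem inner_aliceVector_three_zero : inner ℂ (aliceVector p 3) (aliceVector p 0) =
    (Real.sin p.γ : ℂ) * Real.sin p.θ := by
  rw [aliceVector_three, aliceVector_zero, inner_vec_three]
  simp only [Complex.conj_ofReal, map_mul]
  ring

theorem sq_N : p.N ^ 2 = Real.cos p.γ ^ 2 + Real.sin p.γ ^ 2 * Real.cos p.θ ^ 2 :=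
  Real.sq_sqrt (by positivity)

variable {p}

theorem norm_aliceVector (hN : p.N ≠ 0) : ∀ i, ‖aliceVector p i‖ = 1 := by
  have hE := conj_exp_I_mul_mul_self p.φ
  have hθ : (Real.cos p.θ : ℂ) ^ 2 + (Real.sin p.θ : ℂ) ^ 2 = 1 := by
    exact_mod_cast Real.cos_sq_add_sin_sq p.θ
  have hγ : (Real.cos p.γ : ℂ) ^ 2 + (Real.sin p.γ : ℂ) ^ 2 = 1 := by
    exact_mod_cast Real.cos_sq_add_sin_sq p.γ
  have hN2 : (p.N : ℂ) ^ 2 = (Real.cos p.γ : ℂ) ^ 2 + (Real.sin p.γ : ℂ) ^ 2 *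
      (Real.cos p.θ : ℂ) ^ 2 := by exact_mod_cast p.sq_N
  have hN' : (p.N : ℂ) ≠ 0 := by exact_mod_cast hN
  have hNinv : (1 / (p.N : ℂ)) ^ 2 * (p.N : ℂ) ^ 2 = 1 := by field_simp
  have hconj : starRingEnd ℂ (1 / (p.N : ℂ)) = 1 / (p.N : ℂ) := by
    rw [map_div₀, map_one, Complex.conj_ofReal]
  rw [forall_fin_five]
  refine ⟨?_, ?_, ?_, ?_, ?_⟩ <;> apply norm_eq_one_of_inner_self
  · rw [aliceVector_zero, inner_vec_three]
    simp
  · rw [aliceVector_one, inner_vec_three]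
    simp
  · rw [aliceVector_two, inner_vec_three]
    simp only [Complex.conj_ofReal, map_zero]
    linear_combination hθ
  · rw [aliceVector_three, inner_vec_three]
    simp only [Complex.conj_ofReal, map_neg, map_mul]
    linear_combination (Real.cos p.γ : ℂ) ^ 2 * hE + (Real.sin p.γ : ℂ) ^ 2 * hθ + hγ
  · rw [aliceVector_four, inner_smul_left, inner_smul_right, inner_vec_three, hconj]
    simp only [Complex.conj_ofReal, map_zero, map_mul]
    linear_combination (1 / (p.N : ℂ)) ^ 2 * (Real.sin p.γ : ℂ) ^ 2 * (Real.cos p.θ : ℂ) ^ 2 * hE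
      - (1 / (p.N : ℂ)) ^ 2 * hN2 + hNinv

theorem Nondegenerate.N_ne_zero (hp : p.Nondegenerate) : p.N ≠ 0 := by
  intro h
  have h2 := p.sq_N
  have h3 : 0 < Real.cos p.γ ^ 2 := sq_pos_of_ne_zero hp.2.1
  have h4 : 0 ≤ Real.sin p.γ ^ 2 * Real.cos p.θ ^ 2 := by positivity
  rw [h] at h2
  nlinarith

theorem Nondegenerate.isPentagon (hp : p.Nondegenerate) : IsPentagon (aliceVector p) := by
  obtain ⟨hcθ, hcγ, hsθ, hsγ⟩ := hp
  have hN := Nondegenerate.N_ne_zero ⟨hcθ, hcγ, hsθ, hsγ⟩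
  have hE := Complex.exp_ne_zero (Complex.I * p.φ)
  refine IsPentagon.of_inner (norm_aliceVector hN) p.inner_aliceVector_add_one ?_
  rw [forall_fin_five]
  refine ⟨?_, ?_, ?_, ?_, ?_⟩
  · rw [show (0 : Fin 5) + 2 = 2 from rfl, inner_aliceVector_zero_two]
    exact_mod_cast hcθ
  · rw [show (1 : Fin 5) + 2 = 3 from rfl, inner_aliceVector_one_three]
    exact mul_ne_zero (by exact_mod_cast hcγ) hE
  · rw [show (2 : Fin 5) + 2 = 4 from rfl, aliceVector_two, aliceVector_four, inner_smul_right,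
      inner_vec_three]
    simp [-Complex.ofReal_cos, -Complex.ofReal_sin, hcγ, hsθ, hN]
  · rw [show (3 : Fin 5) + 2 = 0 from rfl, inner_aliceVector_three_zero]
    exact_mod_cast mul_ne_zero hsγ hsθ
  · rw [show (4 : Fin 5) + 2 = 1 from rfl, aliceVector_four, aliceVector_one, inner_smul_left,
      inner_vec_three]
    simp [-Complex.ofReal_cos, -Complex.ofReal_sin, hcθ, hsγ, hN, hE]

/-- Three diagonals suffice: their inner products are cos θ, cos γ times a phase, and sin γ sin θ.
-/
theorem nondegenerate_of_inner_ne_zero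
    (h : ∀ i, inner ℂ (aliceVector p i) (aliceVector p (i + 2)) ≠ 0) : p.Nondegenerate := by
  have h0 := h 0
  have h1 := h 1
  have h3 := h 3
  rw [show (0 : Fin 5) + 2 = 2 from rfl, inner_aliceVector_zero_two] at h0
  rw [show (1 : Fin 5) + 2 = 3 from rfl, inner_aliceVector_one_three] at h1
  rw [show (3 : Fin 5) + 2 = 0 from rfl, inner_aliceVector_three_zero] at h3
  exact ⟨by exact_mod_cast h0, by exact_mod_cast left_ne_zero_of_mul h1,
    by exact_mod_cast right_ne_zero_of_mul h3, by exact_mod_cast left_ne_zero_of_mul h3⟩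

variable (p)

theorem bobVector_zero : bobVector p 0 = aliceVector p 1 := rfl

theorem bobVector_one : bobVector p 1 = aliceVector p 3 := rfl

theorem bobVector_two : bobVector p 2 = aliceVector p 0 := rfl

theorem bobVector_three : bobVector p 3 = aliceVector p 2 := rfl

theorem bobVector_four : bobVector p 4 = aliceVector p 4 := by
  have h : bobVector p 4 = (1 / (p.N : ℂ)) • !₂[0,
    (Real.sin p.γ : ℂ) * Real.cos p.θ * Complex.exp (Complex.I * p.φ), (Real.cos p.γ : ℂ)] := rfl
  rw [h, aliceVector_four]

/-- Bob's list, read in pentagram order, is Alice's list reflected, so facts about her pentagon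
transfer to his. -/
theorem bobVector_eq : ∀ i : Fin 5, bobVector p (2 * i) = aliceVector p (1 - i) := by
  rw [forall_fin_five]
  refine ⟨?_, ?_, ?_, ?_, ?_⟩
  · rw [show (2 : Fin 5) * 0 = 0 from rfl, show (1 : Fin 5) - 0 = 1 from rfl, bobVector_zero]
  · rw [show (2 : Fin 5) * 1 = 2 from rfl, show (1 : Fin 5) - 1 = 0 from rfl, bobVector_two]
  · rw [show (2 : Fin 5) * 2 = 4 from rfl, show (1 : Fin 5) - 2 = 4 from rfl, bobVector_four]
  · rw [show (2 : Fin 5) * 3 = 1 from rfl, show (1 : Fin 5) - 3 = 3 from rfl, bobVector_one]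
  · rw [show (2 : Fin 5) * 4 = 3 from rfl, show (1 : Fin 5) - 4 = 2 from rfl, bobVector_three]

variable {p}

theorem isPentagon_bobVector (hp : IsPentagon (aliceVector p)) :
    IsPentagon fun i => bobVector p (2 * i) := by
  have hd : ∀ i j : Fin 5, (1 - j = 1 - i + 1 ∨ 1 - i = 1 - j + 1) ↔ (j = i + 1 ∨ i = j + 1) := by
    decide
  refine ⟨fun i => ?_, fun i j => ?_⟩
  · rw [bobVector_eq, hp.norm_eq]
  · rw [bobVector_eq, bobVector_eq, hp.inner_eq_zero_iff, hd]

theorem aliceVector_eq_bobVector (i : Fin 5) : aliceVector p i = bobVector p (2 * (1 - i)) := by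
  rw [bobVector_eq, sub_sub_cancel]

theorem aliceVector_four_eq_zero (hN : p.N = 0) : aliceVector p 4 = 0 := by
  change (1 / (p.N : ℂ)) • _ = (0 : Qudit 3)
  rw [hN, Complex.ofReal_zero, div_zero, zero_smul]

end Angles

/-- For necessity, a vanishing diagonal completes two consecutive cycle edges to a triangle, which a
UPB cannot contain. -/
theorem isUPB_sixParameterSet_iff (p q : Angles) :
    IsUPB (sixParameterSet p q) ↔ p.Nondegenerate ∧ q.Nondegenerate := by
  refine ⟨fun h => ?_, fun h => h.1.isPentagon.isUPB (Angles.isPentagon_bobVector h.2.isPentagon)⟩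
  have hmem : ∀ i, aliceVector p i ⊗ₜ[ℂ] bobVector q i ∈ sixParameterSet p q := fun i => ⟨i, rfl⟩
  -- If N were 0 for either party, member 4 would be the zero vector and not a product state.
  have hne := ((isUPB_iff.1 h).1.1 _ (hmem 4)).ne_zero
  have hp : p.N ≠ 0 := fun h0 => hne (by
    rw [Angles.aliceVector_four_eq_zero h0, TensorProduct.zero_tmul])
  have hq : q.N ≠ 0 := fun h0 => hne (by
    rw [Angles.bobVector_four, Angles.aliceVector_four_eq_zero h0, TensorProduct.tmul_zero])
  have hα := Angles.norm_aliceVector hp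
  have hβ : ∀ i, ‖bobVector q i‖ = 1 := fun i => by
    have hdouble : ∀ i : Fin 5, 2 * (3 * i) = i := by decide
    rw [← hdouble i, Angles.bobVector_eq, Angles.norm_aliceVector hq]
  have hadd : ∀ i : Fin 5, i + 1 + 1 = i + 2 := by decide
  have hstep : ∀ (r : Angles) (i : Fin 5),
      inner ℂ (aliceVector r (i + 1)) (aliceVector r (i + 2)) = 0 := fun r i =>
    hadd i ▸ r.inner_aliceVector_add_one (i + 1)
  constructor
  · refine Angles.nondegenerate_of_inner_ne_zero fun i h0 => h.not_hasTriangle ?_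
    exact hasTriangle_of_left hα hβ hmem (p.inner_aliceVector_add_one i) h0 (hstep p i)
  · refine Angles.nondegenerate_of_inner_ne_zero fun i h0 => h.not_hasTriangle ?_
    have h1 := q.inner_aliceVector_add_one i
    have h2 := hstep q i
    rw [Angles.aliceVector_eq_bobVector, Angles.aliceVector_eq_bobVector] at h0 h1 h2
    exact hasTriangle_of_right hα hβ hmem h1 h0 h2

/-! ### Normal form of a pentagon up to unitaries and phases -/

theorem exists_cos_sin_eq {c s : ℝ} (h : c ^ 2 + s ^ 2 = 1) :
    ∃ θ : ℝ, Real.cos θ = c ∧ Real.sin θ = s := by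
  have hn : ‖(⟨c, s⟩ : ℂ)‖ = 1 := by
    rw [← sq_eq_sq₀ (norm_nonneg _) zero_le_one, Complex.sq_norm, Complex.normSq_mk]
    linarith
  refine ⟨Complex.arg ⟨c, s⟩, ?_, ?_⟩
  · simpa [hn] using Complex.norm_mul_cos_arg ⟨c, s⟩
  · simpa [hn] using Complex.norm_mul_sin_arg ⟨c, s⟩

theorem norm_div_norm_self {z : ℂ} (hz : z ≠ 0) : ‖z / (‖z‖ : ℂ)‖ = 1 := by
  rw [norm_div, Complex.norm_real, norm_norm, div_self (norm_ne_zero_iff.2 hz)]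

theorem OrthonormalBasis.repr_eq_vec (e : OrthonormalBasis (Fin 3) ℂ (Qudit 3)) (x : Qudit 3) :
    e.repr x = !₂[inner ℂ (e 0) x, inner ℂ (e 1) x, inner ℂ (e 2) x] := by
  ext i
  rw [OrthonormalBasis.repr_apply_apply]
  fin_cases i <;> rfl

theorem IsPentagon.reflect {d : ℕ} {v : Fin 5 → Qudit d} (hv : IsPentagon v) :
    IsPentagon fun i => v (1 - i) := by
  have hd : ∀ i j : Fin 5, (1 - j = 1 - i + 1 ∨ 1 - i = 1 - j + 1) ↔ (j = i + 1 ∨ i = j + 1) := by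
    decide
  exact ⟨fun i => hv.norm_eq _, fun i j => by rw [hv.inner_eq_zero_iff, hd]⟩

/-- In suitable coordinates the first four vectors of a pentagon have the standard form. -/
theorem IsPentagon.exists_angles_first_four {a : Fin 5 → Qudit 3} (ha : IsPentagon a) :
    ∃ (p : Angles) (U : Qudit 3 ≃ₗᵢ[ℂ] Qudit 3), p.Nondegenerate ∧ U (a 0) = aliceVector p 0 ∧
      U (a 1) = aliceVector p 1 ∧ (∃ c : ℂ, ‖c‖ = 1 ∧ U (a 2) = c • aliceVector p 2) ∧
      ∃ c : ℂ, ‖c‖ = 1 ∧ U (a 3) = c • aliceVector p 3 := by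
  have h := ha.inner_eq_zero_iff
  have hn : ∀ i, inner ℂ (a i) (a i) = 1 := fun i => by
    rw [inner_self_eq_norm_sq_to_K, ha.norm_eq]
    simp
  set x : ℂ := inner ℂ (a 0) (a 2) with hx
  have hx0 : x ≠ 0 := fun h0 => by simpa using (h 0 2).1 h0
  set C : ℝ := ‖x‖ with hC
  have hC0 : C ≠ 0 := norm_ne_zero_iff.2 hx0
  have hCC : (C : ℂ) ≠ 0 := by exact_mod_cast hC0
  -- the third vector, with its phase chosen such that its first coordinate is positive
  set u : Qudit 3 := ((C : ℂ) / x) • a 2 with hu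
  have hcu : ‖(C : ℂ) / x‖ = 1 := by
    rw [norm_div, Complex.norm_real, Real.norm_of_nonneg (norm_nonneg x), div_self hC0]
  have hun : ‖u‖ = 1 := by rw [hu, norm_smul, hcu, ha.norm_eq, one_mul]
  have h0u : inner ℂ (a 0) u = (C : ℂ) := by
    rw [hu, inner_smul_right, ← hx, div_mul_cancel₀ _ hx0]
  have h1u : inner ℂ (a 1) u = 0 := by
    rw [hu, inner_smul_right, (h 1 2).2 (by decide), mul_zero]
  set r : Qudit 3 := u - (C : ℂ) • a 0 with hr
  have h0r : inner ℂ (a 0) r = 0 := by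
    rw [hr, inner_sub_right, h0u, inner_smul_right, hn, mul_one, sub_self]
  have h1r : inner ℂ (a 1) r = 0 := by
    rw [hr, inner_sub_right, h1u, inner_smul_right, (h 1 0).2 (by decide), mul_zero, sub_zero]
  -- Otherwise a 2 would be parallel to a 0 and hence orthogonal to a 4, contrary to the pentagon
  -- pattern.
  have hr0 : r ≠ 0 := by
    intro h0
    have h42 : inner ℂ (a 4) u = 0 := by
      rw [sub_eq_zero.1 h0, inner_smul_right, (h 4 0).2 (by decide), mul_zero]
    rw [hu, inner_smul_right, mul_eq_zero] at h42
    rcases h42 with h42 | h42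
    · exact div_ne_zero hCC hx0 h42
    · simpa using (h 4 2).1 h42
  set s : ℝ := ‖r‖ with hs
  have hs0 : s ≠ 0 := norm_ne_zero_iff.2 hr0
  have hsC : (s : ℂ) ≠ 0 := by exact_mod_cast hs0
  have hur : u = r + (C : ℂ) • a 0 := by rw [hr, sub_add_cancel]
  have hrr : inner ℂ r r = (s : ℂ) ^ 2 := by
    rw [inner_self_eq_norm_sq_to_K]
    rfl
  have hru : inner ℂ r u = (s : ℂ) ^ 2 := by
    rw [hur, inner_add_right, inner_smul_right, inner_eq_zero_symm.1 h0r, hrr, mul_zero, add_zero]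
  have hsum : C ^ 2 + s ^ 2 = 1 := by
    have h1 : inner ℂ u u = 1 := by
      rw [inner_self_eq_norm_sq_to_K, hun]
      simp
    nth_rw 1 [hur] at h1
    rw [inner_add_left, inner_smul_left, hru, h0u, Complex.conj_ofReal] at h1
    have h2 : ((C ^ 2 + s ^ 2 : ℝ) : ℂ) = ((1 : ℝ) : ℂ) := by
      push_cast
      linear_combination h1
    exact_mod_cast h2
  obtain ⟨θ, hcθ, hsθ⟩ := exists_cos_sin_eq hsum
  have hon : Orthonormal ℂ ![a 0, a 1, ((s : ℂ)⁻¹) • r] := by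
    refine orthonormal_vec_three (ha.norm_eq 0) (ha.norm_eq 1) ?_ ((h 0 1).2 (by decide)) ?_ ?_
    · rw [norm_smul, norm_inv, Complex.norm_real, Real.norm_of_nonneg (norm_nonneg r),
        inv_mul_cancel₀ hs0]
    · rw [inner_smul_right, h0r, mul_zero]
    · rw [inner_smul_right, h1r, mul_zero]
  obtain ⟨e, he⟩ := (hon.comp _ Subtype.val_injective : Orthonormal ℂ
    ((Set.univ : Set (Fin 3)).domRestrict
      ![a 0, a 1, ((s : ℂ)⁻¹) • r])).exists_orthonormalBasis_extension_of_card_eq (by simp)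
  have he0 : e 0 = a 0 := he 0 (Set.mem_univ _)
  have he1 : e 1 = a 1 := he 1 (Set.mem_univ _)
  have he2 : e 2 = ((s : ℂ)⁻¹) • r := he 2 (Set.mem_univ _)
  have h2u : inner ℂ (e 2) u = (s : ℂ) := by
    rw [he2, inner_smul_left, hru, map_inv₀, Complex.conj_ofReal, pow_two,
      inv_mul_cancel_left₀ hsC]
  -- the fourth vector
  set t : ℂ := inner ℂ (a 1) (a 3) with ht
  have ht0 : t ≠ 0 := fun h0 => by simpa using (h 1 3).1 h0
  -- Orthogonality to u leaves a 3 the coordinates (s k, t, -C k) in the frame e. Its norm gives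
  -- |t|² + |k|² = 1, which defines γ.
  set k : ℂ := inner ℂ (a 0) (a 3) / (s : ℂ) with hk
  have hk0 : k ≠ 0 := div_ne_zero (fun h0 => by simpa using (h 0 3).1 h0) hsC
  have hkn : (‖k‖ : ℂ) ≠ 0 := by exact_mod_cast norm_ne_zero_iff.2 hk0
  have h03 : inner ℂ (a 0) (a 3) = (s : ℂ) * k := by rw [hk, mul_div_cancel₀ _ hsC]
  have h23 : inner ℂ (e 2) (a 3) = -((C : ℂ) * k) := by
    have hu3 : inner ℂ u (a 3) = 0 := by
      rw [hu, inner_smul_left, (h 2 3).2 (by decide), mul_zero]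
    have hr3 : inner ℂ r (a 3) = -((C : ℂ) * ((s : ℂ) * k)) := by
      rw [hr, inner_sub_left, hu3, inner_smul_left, h03, Complex.conj_ofReal, zero_sub]
    rw [he2, inner_smul_left, hr3, map_inv₀, Complex.conj_ofReal]
    field_simp
  have hkt : ‖t‖ ^ 2 + ‖k‖ ^ 2 = 1 := by
    have h3 := e.sum_sq_norm_inner_right (a 3)
    rw [Fin.sum_univ_three, he0, he1, h03, h23, ← ht, ha.norm_eq, norm_neg, norm_mul, norm_mul,
      Complex.norm_real, Complex.norm_real, mul_pow, mul_pow, Real.norm_eq_abs, Real.norm_eq_abs,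
      sq_abs, sq_abs] at h3
    linear_combination h3 - ‖k‖ ^ 2 * hsum
  obtain ⟨γ, hcγ, hsγ⟩ := exists_cos_sin_eq hkt
  -- Removing the phase k / |k| from a 3 makes its outer coordinates real and turns the middle one
  -- into y, whose argument is φ.
  set y : ℂ := t * (‖k‖ / k) with hy
  have hyn : ‖y‖ = ‖t‖ := by
    rw [hy, norm_mul, norm_div, Complex.norm_real, norm_norm, div_self (norm_ne_zero_iff.2 hk0),
      mul_one]
  have hyexp : (‖t‖ : ℂ) * Complex.exp (Complex.I * (Complex.arg y : ℝ)) = y := by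
    rw [← hyn, mul_comm Complex.I]
    exact Complex.norm_mul_exp_arg_mul_I y
  refine ⟨⟨γ, θ, Complex.arg y⟩, e.repr, ⟨?_, ?_, ?_, ?_⟩, ?_, ?_, ⟨x / C, ?_, ?_⟩,
    ⟨k / ‖k‖, norm_div_norm_self hk0, ?_⟩⟩
  · rwa [hcθ]
  · rw [hcγ]
    exact norm_ne_zero_iff.2 ht0
  · rwa [hsθ]
  · rw [hsγ]
    exact norm_ne_zero_iff.2 hk0
  · rw [OrthonormalBasis.repr_eq_vec, Angles.aliceVector_zero, ← he0, e.inner_eq_one,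
      e.inner_eq_zero (by decide), e.inner_eq_zero (by decide)]
  · rw [OrthonormalBasis.repr_eq_vec, Angles.aliceVector_one, ← he1, e.inner_eq_one,
      e.inner_eq_zero (by decide), e.inner_eq_zero (by decide)]
  · exact norm_div_norm_self hx0
  · have hau : a 2 = (x / (C : ℂ)) • u := by
      rw [hu, smul_smul, div_mul_div_cancel₀ hCC, div_self hx0, one_smul]
    rw [hau, map_smul, OrthonormalBasis.repr_eq_vec, he0, he1, h0u, h1u, h2u,
      Angles.aliceVector_two, hcθ, hsθ]
  · rw [OrthonormalBasis.repr_eq_vec, he0, he1, h03, h23, ← ht, Angles.aliceVector_three]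
    change _ = _ • !₂[(Real.sin γ : ℂ) * Real.sin θ,
      (Real.cos γ : ℂ) * Complex.exp (Complex.I * (Complex.arg y : ℝ)),
      -((Real.sin γ : ℂ) * Real.cos θ)]
    rw [hcθ, hsθ, hcγ, hsγ, hyexp, hy]
    ext i
    fin_cases i
    · change (s : ℂ) * k = k / ‖k‖ * (‖k‖ * s)
      field_simp
    · change t = k / ‖k‖ * (t * (‖k‖ / k))
      field_simp
    · change -((C : ℂ) * k) = k / ‖k‖ * -(‖k‖ * C)
      field_simp

theorem IsPentagon.exists_angles {a : Fin 5 → Qudit 3} (ha : IsPentagon a) :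
    ∃ (p : Angles) (U : Qudit 3 ≃ₗᵢ[ℂ] Qudit 3), p.Nondegenerate ∧
      ∀ i, ∃ c : ℂ, ‖c‖ = 1 ∧ U (a i) = c • aliceVector p i := by
  obtain ⟨p, U, hp, h0, h1, h2, c, hc, h3⟩ := ha.exists_angles_first_four
  have hv := hp.isPentagon
  have h := hv.inner_eq_zero_iff
  refine ⟨p, U, hp, forall_fin_five.2 ⟨⟨1, by simp, by rw [h0, one_smul]⟩,
    ⟨1, by simp, by rw [h1, one_smul]⟩, h2, ⟨c, hc, h3⟩, ?_⟩⟩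
  have hne : ∀ i, aliceVector p i ≠ 0 := fun i h0 => by simpa [h0] using hv.norm_eq i
  have hc0 : c ≠ 0 := by
    rintro rfl
    simp at hc
  -- The fifth vector is determined up to a scalar by orthogonality to the vectors 0 and 3.
  have hmem : U (a 4) ∈ Submodule.span ℂ {aliceVector p 4} := by
    refine mem_span_of_orthogonal_pair (hne 0) (v := aliceVector p 3) (fun hmem => ?_)
      ((h 0 4).2 (by decide)) ((h 3 4).2 (by decide)) ?_ ?_ (hne 4)
    · have := inner_eq_zero_of_mem_span_singleton hmem ((h 0 1).2 (by decide))
      simpa using (h 3 1).1 this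
    · rw [← h0, U.inner_map_map, (ha.inner_eq_zero_iff 0 4).2 (by decide)]
    · have h4 : inner ℂ (U (a 3)) (U (a 4)) = 0 := by
        rw [U.inner_map_map, (ha.inner_eq_zero_iff 3 4).2 (by decide)]
      rw [h3, inner_smul_left, mul_eq_zero] at h4
      exact h4.resolve_left (by simpa using hc0)
  obtain ⟨d, hd⟩ := Submodule.mem_span_singleton.1 hmem
  refine ⟨d, ?_, hd.symm⟩
  have := congrArg norm hd
  rwa [norm_smul, hv.norm_eq, mul_one, U.norm_map, ha.norm_eq] at this

theorem IsUPB.exists_locallyUnitarilyEquivalent {S : Set (Bipartite 3 3)} (hS : IsUPB S) :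
    ∃ p q : Angles, p.Nondegenerate ∧ q.Nondegenerate ∧
      LocallyUnitarilyEquivalent S (sixParameterSet p q) := by
  obtain ⟨a, b, ha, hb, rfl⟩ := hasPentagonGraph_iff.1 hS.hasPentagonGraph
  obtain ⟨p, U, hp, hU⟩ := ha.exists_angles
  obtain ⟨q, V, hq, hV⟩ := hb.reflect.exists_angles
  have key : ∀ i, ∃ c : ℂ, ‖c‖ = 1 ∧ TensorProduct.map (U.toLinearEquiv : Qudit 3 →ₗ[ℂ] Qudit 3)
      (V.toLinearEquiv : Qudit 3 →ₗ[ℂ] Qudit 3) (a i ⊗ₜ[ℂ] b i) =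
      c • (aliceVector p i ⊗ₜ[ℂ] bobVector q i) := by
    intro i
    have hi : 2 * (1 - (1 - 3 * i)) = i := by
      revert i
      decide
    obtain ⟨c, hc, hci⟩ := hU i
    obtain ⟨d, hd, hdi⟩ := hV (1 - 3 * i)
    rw [Angles.aliceVector_eq_bobVector, hi] at hdi
    refine ⟨c * d, by rw [norm_mul, hc, hd, one_mul], ?_⟩
    change U (a i) ⊗ₜ[ℂ] V (b i) = _
    rw [hci, hdi, TensorProduct.smul_tmul_smul]
  refine ⟨p, q, hp, hq, U, V, ?_, ?_⟩
  · rintro _ ⟨_, ⟨i, rfl⟩, rfl⟩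
    exact ⟨_, ⟨i, rfl⟩, key i⟩
  · rintro _ ⟨i, rfl⟩
    exact ⟨_, ⟨_, ⟨i, rfl⟩, rfl⟩, key i⟩

/-! ### The separable measurement -/

/-- The operator `|a⟩⟨a|`. -/
noncomputable def ketBra {d : ℕ} (a : Qudit d) : Qudit d →ₗ[ℂ] Qudit d :=
  (innerₛₗ ℂ a).smulRight a

theorem ketBra_apply {d : ℕ} (a x : Qudit d) : ketBra a x = inner ℂ a x • a := rfl

theorem adjoint_ketBra {d : ℕ} (a : Qudit d) : (ketBra a).adjoint = ketBra a := by
  symm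
  rw [LinearMap.eq_adjoint_iff]
  intro x y
  rw [ketBra_apply, ketBra_apply, inner_smul_left, inner_smul_right, inner_conj_symm, mul_comm]

theorem ketBra_comp_self {d : ℕ} {a : Qudit d} (ha : ‖a‖ = 1) :
    ketBra a ∘ₗ ketBra a = ketBra a := by
  ext1 x
  rw [LinearMap.comp_apply, ketBra_apply a x, ketBra_apply, inner_smul_right,
    inner_self_eq_norm_sq_to_K, ha]
  simp

theorem map_ketBra_apply {m n : ℕ} (a : Qudit m) (b : Qudit n) (v : Bipartite m n) :
    TensorProduct.map (ketBra a) (ketBra b) v =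
      (inner ℂ (a ⊗ₜ[ℂ] b) v : ℂ) • (a ⊗ₜ[ℂ] b) := by
  induction v using TensorProduct.induction_on with
  | zero => rw [map_zero, inner_zero_right, zero_smul]
  | tmul x y =>
    rw [TensorProduct.map_tmul, ketBra_apply, ketBra_apply, TensorProduct.smul_tmul_smul,
      TensorProduct.inner_tmul]
  | add x y hx hy => rw [map_add, hx, hy, inner_add_right, add_smul]

/-- A resolution of the identity into weighted product projectors, grouped into outcomes each of
which only responds to one member of `S`, gives a separable measurement that distinguishes the
members of `S`. -/
theorem isSeparablyDistinguishable_of_resolution {m n N : ℕ} {S : Set (Bipartite m n)}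
    {J : Fin N → Type*} [∀ k, Fintype (J k)] (X : ∀ k, J k → Bipartite m n)
    (hX : ∀ k j, IsProductState (X k j)) (w : ∀ k, J k → ℝ) (hw : ∀ k j, 0 ≤ w k j)
    (hsum : ∀ v : Bipartite m n, ∑ k, ∑ j, (w k j : ℂ) • ((inner ℂ (X k j) v : ℂ) • X k j) = v)
    (s : Fin N → Bipartite m n)
    (hs : ∀ k j, ∀ x ∈ S, x ≠ s k → (inner ℂ (X k j) x : ℂ) = 0) :
    IsSeparablyDistinguishable S := by
  choose α β hα hβ hαβ using hX
  let f : ∀ k, Fin (Fintype.card (J k)) ≃ J k := fun k => (Fintype.equivFin (J k)).symm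
  let M : SeparableMeasurement m n :=
    { numOutcomes := N
      numElements := fun k => Fintype.card (J k)
      m' := m
      n' := n
      -- The whole weight sits in Alice's factor, so A†A ⊗ B†B is w times the product projector.
      A := fun k i => ((√(w k (f k i)) : ℝ) : ℂ) • ketBra (α k (f k i))
      B := fun k i => ketBra (β k (f k i))
      complete := by
        refine LinearMap.ext fun v => ?_
        rw [LinearMap.id_apply, LinearMap.sum_apply]
        conv_rhs => rw [← hsum v]
        refine Finset.sum_congr rfl fun k _ => ?_
        rw [LinearMap.sum_apply, ← (f k).sum_comp]
        refine Finset.sum_congr rfl fun i _ => ?_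
        rw [map_smulₛₗ, adjoint_ketBra, adjoint_ketBra, ketBra_comp_self (hβ _ _),
          LinearMap.smul_comp, LinearMap.comp_smul, ketBra_comp_self (hα _ _), Complex.conj_ofReal,
          smul_smul, ← Complex.ofReal_mul, Real.mul_self_sqrt (hw _ _), TensorProduct.map_smul_left,
          LinearMap.smul_apply, map_ketBra_apply, ← hαβ] }
  have hzero : ∀ k : Fin N, ∀ x ∈ S, x ≠ s k → M.prob k x = 0 := by
    intro k x hx hxs
    refine Finset.sum_eq_zero fun i _ => ?_
    change ‖TensorProduct.map (((√(w k (f k i)) : ℝ) : ℂ) • ketBra (α k (f k i)))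
      (ketBra (β k (f k i))) x‖ ^ 2 = 0
    rw [TensorProduct.map_smul_left, LinearMap.smul_apply, map_ketBra_apply, ← hαβ,
      hs k (f k i) x hx hxs, zero_smul, smul_zero, norm_zero, zero_pow two_ne_zero]
  refine ⟨M, fun k x hx y hy hpx hpy => ?_⟩
  have h1 : x = s k := by
    by_contra h
    exact hpx (hzero k x hx h)
  have h2 : y = s k := by
    by_contra h
    exact hpy (hzero k y hy h)
  rw [h1, h2]

theorem IsPB.sum_inner_smul_eq {m n : ℕ} {T : Finset (Bipartite m n)}
    (hT : IsPB (T : Set (Bipartite m n))) (htop : Submodule.span ℂ (T : Set (Bipartite m n)) = ⊤)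
    (v : Bipartite m n) : ∑ t ∈ T, (inner ℂ t v : ℂ) • t = v := by
  have hor : Orthonormal ℂ ((↑) : T → Bipartite m n) := hT.orthonormal
  have hspan : (⊤ : Submodule ℂ (Bipartite m n)) ≤
      Submodule.span ℂ (Set.range ((↑) : T → Bipartite m n)) := by
    rw [Subtype.range_coe_subtype]
    exact htop.ge
  have := (OrthonormalBasis.mk hor hspan).sum_repr' v
  rw [OrthonormalBasis.coe_mk] at this
  rw [← Finset.sum_coe_sort]
  exact this

/-- Omitting one member from a pentagon leaves a completable product basis. -/
theorem IsPentagon.isCompletable_compl {a b : Fin 5 → Qudit 3} (ha : IsPentagon a)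
    (hb : IsPentagon fun i => b (2 * i)) (k : Fin 5) :
    IsCompletable ((fun i => a i ⊗ₜ[ℂ] b i) '' {k}ᶜ) := by
  have hPB : IsPB ((fun i => a i ⊗ₜ[ℂ] b i) '' {k}ᶜ) :=
    have h := ha.isPB hb
    ⟨fun x hx => h.1 x (Set.image_subset_range _ _ hx), fun x hx y hy =>
      h.2 x (Set.image_subset_range _ _ hx) y (Set.image_subset_range _ _ hy)⟩
  have hb1 : ∀ i, ‖b i‖ = 1 := fun i => by
    have hi : 2 * (3 * i) = i := by
      revert i
      decide
    simpa [hi] using hb.norm_eq (3 * i)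
  obtain ⟨x, hx, hx1, hx2⟩ := exists_unit_orthogonal_pair (a (k + 1)) (a (k + 2))
  obtain ⟨y, hy, hy3, hy4⟩ := exists_unit_orthogonal_pair (b (k + 3)) (b (k + 4))
  have hcases : ∀ i k : Fin 5, i ≠ k → i = k + 1 ∨ i = k + 2 ∨ i = k + 3 ∨ i = k + 4 := by decide
  have hz : x ⊗ₜ[ℂ] y ∈ complementarySubspace ((fun i => a i ⊗ₜ[ℂ] b i) '' {k}ᶜ) := by
    rw [mem_complementarySubspace]
    rintro _ ⟨i, hi, rfl⟩
    change inner ℂ (a i ⊗ₜ[ℂ] b i) (x ⊗ₜ[ℂ] y) = 0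
    rw [TensorProduct.inner_tmul, mul_eq_zero]
    rcases hcases i k hi with rfl | rfl | rfl | rfl
    · exact Or.inl (inner_eq_zero_symm.1 hx1)
    · exact Or.inl (inner_eq_zero_symm.1 hx2)
    · exact Or.inr (inner_eq_zero_symm.1 hy3)
    · exact Or.inr (inner_eq_zero_symm.1 hy4)
  have hPB' := hPB.insert ⟨x, y, hx, hy, rfl⟩ hz
  have hne : ∀ k : Fin 5, k + 1 ≠ k ∧ k + 2 ≠ k ∧ k + 2 = k + 1 + 1 := by decide
  -- The adjoined state supplies the triangle: x is orthogonal to the consecutive vectors a (k + 1)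
  -- and a (k + 2), which are orthogonal to each other.
  have htri : HasTriangle (insert (x ⊗ₜ[ℂ] y) ((fun i => a i ⊗ₜ[ℂ] b i) '' {k}ᶜ)) := by
    refine hasTriangle_of_left (α := ![x, a (k + 1), a (k + 2)]) (β := ![y, b (k + 1), b (k + 2)])
      (i := 0) (j := 1) (k := 2) ?_ ?_ ?_ hx1 hx2
      ((ha.inner_eq_zero_iff _ _).2 (Or.inl (hne k).2.2))
    · simp [Fin.forall_fin_succ, hx, ha.norm_eq]
    · simp [Fin.forall_fin_succ, hy, hb1]
    · intro i
      fin_cases i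
      · exact Set.mem_insert _ _
      · exact Set.mem_insert_of_mem _ ⟨k + 1, (hne k).1, rfl⟩
      · exact Set.mem_insert_of_mem _ ⟨k + 2, (hne k).2.1, rfl⟩
  obtain ⟨T, hST, hT⟩ := hPB'.isCompletable_of_hasTriangle htri
  exact ⟨T, (Set.subset_insert _ _).trans hST, hT⟩

/-- Take F to be the states that complete the four members other than k to a full product basis;
they resolve the complement of those four and need not be orthogonal to member k. -/
theorem IsPentagon.exists_projector_decomposition {a b : Fin 5 → Qudit 3} (ha : IsPentagon a)
    (hb : IsPentagon fun i => b (2 * i)) (hinj : Function.Injective fun i => a i ⊗ₜ[ℂ] b i)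
    (k : Fin 5) : ∃ F : Finset (Bipartite 3 3), (∀ t ∈ F, IsProductState t) ∧
      (∀ t ∈ F, ∀ i, i ≠ k → (inner ℂ t (a i ⊗ₜ[ℂ] b i) : ℂ) = 0) ∧
      ∀ v, ∑ t ∈ F, (inner ℂ t v : ℂ) • t +
        ∑ i ∈ Finset.univ.erase k, (inner ℂ (a i ⊗ₜ[ℂ] b i) v : ℂ) • (a i ⊗ₜ[ℂ] b i) = v := by
  classical
  obtain ⟨T, hST, hT, htop⟩ := ha.isCompletable_compl hb k
  lift T to Finset (Bipartite 3 3) using hT.finite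
  set R : Finset (Bipartite 3 3) := (Finset.univ.erase k).image fun i => a i ⊗ₜ[ℂ] b i with hR
  have hRT : R ⊆ T := by
    intro x hx
    obtain ⟨i, hi, rfl⟩ := Finset.mem_image.1 hx
    exact hST ⟨i, Finset.ne_of_mem_erase hi, rfl⟩
  have hmemR : ∀ i, i ≠ k → a i ⊗ₜ[ℂ] b i ∈ R := fun i hi =>
    Finset.mem_image_of_mem _ (Finset.mem_erase.2 ⟨hi, Finset.mem_univ _⟩)
  refine ⟨T \ R, fun t ht => hT.1 t (Finset.mem_sdiff.1 ht).1, fun t ht i hi => ?_, fun v => ?_⟩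
  · refine hT.2 t (Finset.mem_sdiff.1 ht).1 _ (hRT (hmemR i hi)) ?_
    rintro rfl
    exact (Finset.mem_sdiff.1 ht).2 (hmemR i hi)
  · have h1 := Finset.sum_sdiff (f := fun t => (inner ℂ t v : ℂ) • t) hRT
    rw [hT.sum_inner_smul_eq htop v, hR, Finset.sum_image hinj.injOn] at h1
    exact h1

theorem IsUPB.isSeparablyDistinguishable {S : Set (Bipartite 3 3)} (hS : IsUPB S) :
    IsSeparablyDistinguishable S := by
  have hcard := hS.ncard_eq_five
  have hPB := (isUPB_iff.1 hS).1
  obtain ⟨a, b, ha, hb, rfl⟩ := hasPentagonGraph_iff.1 hS.hasPentagonGraph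
  -- Distinctness of the five states is recovered from the cardinality of the set.
  have hinj : Function.Injective fun i => a i ⊗ₜ[ℂ] b i := by
    rw [← Set.image_univ] at hcard
    exact Set.injOn_univ.1 (Set.injOn_of_ncard_image_eq (by rw [hcard, Set.ncard_univ]; simp))
  choose F hF hFk hFv using ha.exists_projector_decomposition hb hinj
  refine isSeparablyDistinguishable_of_resolution (J := fun k => Option (F k))
    (fun k j => j.elim (a k ⊗ₜ[ℂ] b k) Subtype.val) ?_ (fun k j => j.elim (4 / 5) fun _ => 1 / 5)
    ?_ ?_ (fun k => a k ⊗ₜ[ℂ] b k) ?_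
  · rintro k (_ | t)
    · exact hPB.1 _ ⟨k, rfl⟩
    · exact hF k t t.2
  · rintro k (_ | t)
    · change (0 : ℝ) ≤ 4 / 5
      norm_num
    · change (0 : ℝ) ≤ 1 / 5
      norm_num
  · intro v
    -- With P_i the projector onto member i and P their sum, outcome k contributes (4/5) P_k +
    -- (1/5)(1 - P + P_k) = (1/5)(1 - P) + P_k. Summing over the five outcomes gives 1.
    have hk : ∀ k, ∑ j : Option (F k), (((j.elim (4 / 5) fun _ => 1 / 5 : ℝ)) : ℂ) •
        ((inner ℂ (j.elim (a k ⊗ₜ[ℂ] b k) Subtype.val) v : ℂ) •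
          (j.elim (a k ⊗ₜ[ℂ] b k) Subtype.val : Bipartite 3 3)) =
        (1 / 5 : ℂ) • (v - ∑ i, (inner ℂ (a i ⊗ₜ[ℂ] b i) v : ℂ) • (a i ⊗ₜ[ℂ] b i)) +
          (inner ℂ (a k ⊗ₜ[ℂ] b k) v : ℂ) • (a k ⊗ₜ[ℂ] b k) := by
      intro k
      have h1 := hFv k v
      rw [Fintype.sum_option, ← Finset.add_sum_erase _ _ (Finset.mem_univ k)]
      simp only [Option.elim]
      rw [Finset.sum_coe_sort (F k) fun t => (((1 / 5 : ℝ)) : ℂ) • ((inner ℂ t v : ℂ) • t),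
        ← Finset.smul_sum, eq_sub_of_add_eq h1]
      push_cast
      module
    rw [Finset.sum_congr rfl fun k _ => hk k, Finset.sum_add_distrib, Finset.sum_const,
      Finset.card_univ, Fintype.card_fin]
    module
  · rintro k (_ | t) _ ⟨i, rfl⟩ hne
    · exact hPB.2 _ ⟨k, rfl⟩ _ ⟨i, rfl⟩ (Ne.symm hne)
    · exact hFk k t t.2 i fun h => hne (by rw [h])

theorem mainTheorem1 :
    -- every UPB in 3 ⊗ 3 has exactly five members
    (∀ S : Set (Bipartite 3 3), IsUPB S → S.ncard = 5) ∧
    -- the UPBs are exactly the sets of product states with the pentagon orthogonality graph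
    (∀ S : Set (Bipartite 3 3), IsUPB S ↔ HasPentagonGraph S) ∧
    -- up to local unitaries, every UPB is a nondegenerate member of the six-parameter family
    (∀ S : Set (Bipartite 3 3), IsUPB S → ∃ p q : Angles, p.Nondegenerate ∧ q.Nondegenerate ∧
      LocallyUnitarilyEquivalent S (sixParameterSet p q)) ∧
    -- a member of the family is a UPB exactly when it is nondegenerate
    (∀ p q : Angles, IsUPB (sixParameterSet p q) ↔ p.Nondegenerate ∧ q.Nondegenerate) ∧
    -- product bases with six or more members are completable
    (∀ S : Set (Bipartite 3 3), IsPB S → 6 ≤ S.ncard → IsCompletable S) ∧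
    -- every UPB is distinguishable by a separable measurement
    (∀ S : Set (Bipartite 3 3), IsUPB S → IsSeparablyDistinguishable S) :=
  ⟨fun _ hS => hS.ncard_eq_five, fun _ => isUPB_iff_hasPentagonGraph,
    fun _ hS => hS.exists_locallyUnitarilyEquivalent, isUPB_sixParameterSet_iff,
    fun _ hS h6 => hS.isCompletable_of_hasTriangle (hS.hasTriangle_of_six_le h6),
    fun _ hS => hS.isSeparablyDistinguishable⟩
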